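/- Let $p$ be a prime. Let $\mathcal{A}=\mathcal{A}(\mathbb{Z}_p)$ be the following category. An object $M$ consists of a $\mathbb{Q}[\mathbb{Z}/p^k]$-module $M_k$ for every $k\geqslant 0$, a rational discrete $\mathbb{Z}_p$-module $M_\infty$ (that is, a $\mathbb{Q}$-linear $\mathbb{Z}_p$-representation in which the action on each element factors through some quotient $\mathbb{Z}/p^n$), and a map of $\mathbb{Q}[\mathbb{Z}_p]$-modules $M_\infty\to\operatorname{colim}_n\prod_{k\geqslant n}M_k$, called the structure map. A morphism $f\colon M\to N$ consists of $\mathbb{Q}[\mathbb{Z}/p^k]$-linear maps $f_k\colon M_k\to N_k$ and a $\mathbb{Z}_p$-equivariant $\mathbb{Q}$-linear map $f_\infty\colon M_\infty\to N_\infty$ that are compatible with the structure maps. Let $dg\mathcal{A}$ be the category of $\mathbb{Z}$-graded chain complexes in $\mathcal{A}$. For $n\geqslant 0$ let $A(n)\in\mathcal{A}$ be the object with value $\mathbb{Q}[\mathbb{Z}/p^n]$ at all $k\geqslant n$ and at $\infty$, value $0$ at $k<n$, and the diagonal as structure map. For $M\in\mathcal{A}$ and a chain complex $X$ of $\mathbb{Q}$-modules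 let $M\otimes X\in dg\mathcal{A}$ be the pointwise tensor product over $\mathbb{Q}$, with structure map induced by $[(m_k)]\otimes x\mapsto[(m_k\otimes x)]$. For $m\in\mathbb{Z}$ let $S^{m}$ be the complex $\mathbb{Q}$ concentrated in degree $m$, and let $D^{m+1}$ be the complex $\mathbb{Q}\xrightarrow{=}\mathbb{Q}$ in degrees $m+1$ and $m$. Let $I=\{S^m\to D^{m+1}\mid m\in\mathbb{Z}\}$ and $J=\{0\to D^{m+1}\mid m\in\mathbb{Z}\}$ be the standard generating cofibrations and generating acyclic cofibrations of chain complexes of $\mathbb{Q}$-modules. **Theorem.** The category $dg\mathcal{A}(\mathbb{Z}_p)$ has all small limits and colimits, and it carries a model structure in which 1. a map $f$ is a weak equivalence if and only if $f_k$, for every $k\geqslant 0$, and $f_\infty$ are homology isomorphisms; 2. a map $f$ is a fibration if and only if $f_k$, for every $k\geqslant 0$, and $f_\infty$ are surjective (in every degree). This model structure is proper (weak equivalences are stable under pushout along cofibrations and under pullback along fibrations). It is cofibrantly generated, with generating cofibrations $I_{\mathcal{A}}=\{A(n)\otimes i\mid n\geqslant 0,\ i\in I\}$ and generating acyclic cofibrations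 $J_{\mathcal{A}}=\{A(n)\otimes j\mid n\geqslant 0,\ j\in J\}$: both sets permit the small object argument, the fibrations are exactly the maps with the right lifting property with respect to $J_{\mathcal{A}}$, and the acyclic fibrations are exactly the maps with the right lifting property with respect to $I_{\mathcal{A}}$. -/

import Mathlib

open CategoryTheory Limits HomotopicalAlgebra
open scoped ZeroObject TensorProduct

namespace ZpModel

noncomputable section

/-! ### Generalities on model categories -/

section Model

variable (C : Type*) [Category* C]

/-- Properness: weak equivalences are stable under cobase change along cofibrations and
under base change along fibrations. -/
structure IsProper [ModelCategory C] : Prop where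
  left : ∀ {A B X Y : C} (w : A ⟶ X) (i : A ⟶ B) (i' : X ⟶ Y) (w' : B ⟶ Y),
    IsPushout w i i' w' → Cofibration i → WeakEquivalence w → WeakEquivalence w'
  right : ∀ {A B X Y : C} (w' : A ⟶ B) (q : A ⟶ X) (f : B ⟶ Y) (w : X ⟶ Y),
    IsPullback w' q f w → Fibration f → WeakEquivalence w → WeakEquivalence w'

variable {C}

/-- The model structure is cofibrantly generated with `I` the set of generating cofibrations and
`J` the set of generating acyclic cofibrations: `I` and `J` are small, permit the small object
argument, the fibrations are the maps with the right lifting property with respect to `J` and the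
acyclic fibrations those with the right lifting property with respect to `I`. -/
structure IsCofibrantlyGeneratedBy [ModelCategory C] (I J : MorphismProperty C) : Prop where
  small_I : MorphismProperty.HasSmallObjectArgument.{0} I
  small_J : MorphismProperty.HasSmallObjectArgument.{0} J
  rlp_J : J.rlp = fibrations C
  rlp_I : I.rlp = trivialFibrations C

end Model

/-- Pointwise preadditive structure on a product of categories. -/
instance piPreadditive {ι : Type*} (C : ι → Type*) [∀ i, Category* (C i)]
    [∀ i, Preadditive (C i)] : Preadditive (∀ i, C i) where
  homGroup X Y := inferInstanceAs (AddCommGroup (∀ i, X i ⟶ Y i))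
  add_comp _ _ _ f f' g := funext fun i => Preadditive.add_comp _ _ _ (f i) (f' i) (g i)
  comp_add _ _ _ f g g' := funext fun i => Preadditive.comp_add _ _ _ (f i) (g i) (g' i)

instance piEval_additive {ι : Type*} (C : ι → Type*) [∀ i, Category* (C i)]
    [∀ i, Preadditive (C i)] (i : ι) : (Pi.eval C i).Additive where

/-! ### The category `𝓐(ℤ_p)` -/

/-- Families `(M_k)` where `M_k` is a `ℚ[ℤ_p/p^k]`-module, for `k ≥ 0`. -/
abbrev FinPart (p : ℕ) := ∀ k : ℕ, Rep.{0} ℚ (Multiplicative (ZMod (p ^ k)))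

/-- The submodule of `∏_k M_k` of sequences which are eventually zero. -/
def eventuallyZero {p : ℕ} (M : FinPart p) : Submodule ℚ (∀ k, M k) where
  carrier := {x | ∃ n, ∀ k, n ≤ k → x k = 0}
  zero_mem' := ⟨0, fun _ _ => rfl⟩
  add_mem' := by
    rintro x y ⟨n, hn⟩ ⟨m, hm⟩
    refine ⟨max n m, fun k hk => ?_⟩
    simp [hn k (le_trans (le_max_left _ _) hk), hm k (le_trans (le_max_right _ _) hk)]
  smul_mem' := by
    rintro c x ⟨n, hn⟩
    exact ⟨n, fun k hk => by simp [hn k hk]⟩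

/-- The map `∏_k M_k → ∏_k N_k` induced by a family of maps. -/
def seqMap {p : ℕ} {M N : FinPart p} (f : M ⟶ N) : (∀ k, M k) →ₗ[ℚ] (∀ k, N k) :=
  LinearMap.pi fun k => (f k).hom.toLinearMap ∘ₗ LinearMap.proj k

lemma seqMap_le {p : ℕ} {M N : FinPart p} (f : M ⟶ N) :
    eventuallyZero M ≤ (eventuallyZero N).comap (seqMap f) := by
  rintro x ⟨n, hn⟩
  exact ⟨n, fun k hk => by simp [seqMap, hn k hk]⟩

section

variable (p : ℕ) [Fact p.Prime]

/-- The reduction `ℤ_p → ℤ/p^k`, with both groups written multiplicatively. -/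
def red (k : ℕ) : Multiplicative ℤ_[p] →* Multiplicative (ZMod (p ^ k)) :=
  AddMonoidHom.toMultiplicative (PadicInt.toZModPow (p := p) k).toAddMonoidHom

/-- The projection `ℤ/p^k → ℤ/p^n` for `n ≤ k`, with both groups written multiplicatively. -/
def proj {n k : ℕ} (h : n ≤ k) :
    Multiplicative (ZMod (p ^ k)) →* Multiplicative (ZMod (p ^ n)) :=
  AddMonoidHom.toMultiplicative
    (ZMod.castHom (pow_dvd_pow p h) (ZMod (p ^ n))).toAddMonoidHom

lemma proj_red {n k : ℕ} (h : n ≤ k) (g : Multiplicative ℤ_[p]) :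
    proj p h (red p k g) = red p n g := by
  have := DFunLike.congr_fun (PadicInt.zmod_cast_comp_toZModPow (p := p) n k h) g.toAdd
  exact congrArg Multiplicative.ofAdd this

/-- A rational `ℤ_p`-module is discrete if the action on each element factors through some
finite quotient `ℤ/p^n` of `ℤ_p`. -/
def isDiscrete : ObjectProperty (Rep.{0} ℚ (Multiplicative ℤ_[p])) := fun M =>
  ∀ m : M, ∃ n : ℕ, ∀ g : Multiplicative ℤ_[p], red p n g = 1 → M.ρ g m = m

/-- The category of rational discrete `ℤ_p`-modules. -/
abbrev DiscRep := (isDiscrete p).FullSubcategory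

variable {p}

/-- The `ℤ_p`-module `∏_k M_k`. -/
def seqRep (M : FinPart p) : Representation ℚ (Multiplicative ℤ_[p]) (∀ k, M k) where
  toFun g := LinearMap.pi fun k => (M k).ρ (red p k g) ∘ₗ LinearMap.proj k
  map_one' := by ext; simp
  map_mul' _ _ := by ext; simp

lemma eventuallyZero_le (M : FinPart p) (g : Multiplicative ℤ_[p]) :
    eventuallyZero M ≤ (eventuallyZero M).comap (seqRep M g) := by
  rintro x ⟨n, hn⟩
  exact ⟨n, fun k hk => by simp [seqRep, hn k hk]⟩

/-- The `ℤ_p`-module `tails(M) = colim_n ∏_{k ≥ n} M_k`. The transition maps of this sequential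
colimit (forgetting the first entries of a sequence) are surjective, so the colimit is the quotient
of `∏_{k ≥ 0} M_k` by the sequences which become zero in some `∏_{k ≥ n} M_k`. -/
def tailsObj (M : FinPart p) : Rep.{0} ℚ (Multiplicative ℤ_[p]) :=
  Rep.of ((seqRep M).quotient (eventuallyZero M) (eventuallyZero_le M))

/-- The germ at infinity of a sequence, as a linear map `∏_k M_k → tails(M)`. -/
def toTails (M : FinPart p) : (∀ k, M k) →ₗ[ℚ] tailsObj M := (eventuallyZero M).mkQ

variable (p) in
/-- `M ↦ tails(M)` as a functor to (not necessarily discrete) rational `ℤ_p`-modules. -/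
def tails : FinPart p ⥤ Rep.{0} ℚ (Multiplicative ℤ_[p]) where
  obj := tailsObj
  map {M N} f := Rep.ofHom
    { toLinearMap := Submodule.mapQ _ _ (seqMap f) (seqMap_le f)
      isIntertwining' := fun g => by
        refine Submodule.linearMap_qext _ (LinearMap.ext fun x => ?_)
        refine congrArg (Submodule.Quotient.mk (p := eventuallyZero N)) (funext fun k => ?_)
        exact Rep.hom_comm_apply (f k) _ _ }
  map_id M := by
    refine Rep.hom_ext (Representation.IntertwiningMap.ext ?_)
    exact Submodule.linearMap_qext _ (LinearMap.ext fun x => rfl)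
  map_comp f g := by
    refine Rep.hom_ext (Representation.IntertwiningMap.ext ?_)
    exact Submodule.linearMap_qext _ (LinearMap.ext fun x => rfl)

instance : (tails p).Additive where
  map_add {M N f g} := by
    refine Rep.hom_ext (Representation.IntertwiningMap.ext ?_)
    exact Submodule.linearMap_qext _ (LinearMap.ext fun x => rfl)

variable (p)

/-- The algebraic model `𝓐(ℤ_p)`. An object `M` consists of a discrete `ℤ_p`-module
`M_∞ = M.left`, of `ℚ[ℤ_p/p^k]`-modules `M_k = M.right k` for `k ≥ 0`, and of a map of
`ℤ_p`-modules `M.hom : M_∞ → colim_n ∏_{k ≥ n} M_k`; the morphisms are the families of maps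
commuting with the structure maps. -/
abbrev AlgModel := Comma (isDiscrete p).ι (tails p)

/-- The category `dg 𝓐(ℤ_p)` of differential graded objects (`ℤ`-graded chain complexes). -/
abbrev DGAlgModel := ChainComplex (AlgModel p) ℤ

/-- The underlying `ℚ`-module of the value at `∞`. -/
abbrev evInf : AlgModel p ⥤ ModuleCat.{0} ℚ :=
  Comma.fst _ _ ⋙ (isDiscrete p).ι ⋙ forget₂ _ (ModuleCat.{0} ℚ)

/-- The underlying `ℚ`-module of the value at `k`. -/
abbrev evFin (k : ℕ) : AlgModel p ⥤ ModuleCat.{0} ℚ :=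
  Comma.snd _ _ ⋙ Pi.eval _ k ⋙ forget₂ (Rep.{0} ℚ (Multiplicative (ZMod (p ^ k)))) _

/-- The underlying complex of `ℚ`-modules of the value at `∞`. -/
abbrev dgEvInf : DGAlgModel p ⥤ ChainComplex (ModuleCat.{0} ℚ) ℤ :=
  (evInf p).mapHomologicalComplex _

/-- The underlying complex of `ℚ`-modules of the value at `k`. -/
abbrev dgEvFin (k : ℕ) : DGAlgModel p ⥤ ChainComplex (ModuleCat.{0} ℚ) ℤ :=
  (evFin p k).mapHomologicalComplex _

variable {p}

/-- Homology isomorphisms at each `k` and at `∞`. -/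
def IsHomologyIso {X Y : DGAlgModel p} (f : X ⟶ Y) : Prop :=
  (∀ k : ℕ, QuasiIso ((dgEvFin p k).map f)) ∧ QuasiIso ((dgEvInf p).map f)

/-- Maps which are surjective (in each degree) at each `k` and at `∞`. -/
def IsSurjection {X Y : DGAlgModel p} (f : X ⟶ Y) : Prop :=
  (∀ (k : ℕ) (i : ℤ), Function.Surjective (((dgEvFin p k).map f).f i)) ∧
    ∀ i : ℤ, Function.Surjective (((dgEvInf p).map f).f i)

/-! ### The objects `A(n)` -/

variable (p)

/-- `ℚ[ℤ/p^n]` as a module over itself, i.e. the regular representation. -/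
abbrev QZ (n : ℕ) : Type := MonoidAlgebra ℚ (Multiplicative (ZMod (p ^ n)))

/-- The value of `A(n)` at `k`: since `PLift (n ≤ k)` has exactly one element if `n ≤ k` and none
otherwise, this is `ℚ[ℤ/p^n]` for `k ≥ n` and `0` for `k < n`. -/
def genFin (n : ℕ) : FinPart p := fun k => Rep.of (X := PLift (n ≤ k) → QZ p n)
  { toFun := fun g => LinearMap.pi fun h =>
      Representation.leftRegular ℚ (Multiplicative (ZMod (p ^ n))) (proj p h.down g) ∘ₗ
        LinearMap.proj h
    map_one' := by
      refine LinearMap.ext fun x => funext fun h => ?_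
      change Representation.leftRegular ℚ _ (proj p h.down 1) (x h) = x h
      rw [map_one, map_one]
      rfl
    map_mul' := fun g g' => by
      refine LinearMap.ext fun x => funext fun h => ?_
      change Representation.leftRegular ℚ _ (proj p h.down (g * g')) (x h) = _
      rw [map_mul, map_mul]
      rfl }

/-- The value of `A(n)` at `∞`, i.e. `ℚ[ℤ/p^n]`. -/
def genInf (n : ℕ) : DiscRep p where
  obj := Rep.of ((Representation.leftRegular ℚ (Multiplicative (ZMod (p ^ n)))).comp (red p n))
  property m := ⟨n, fun g hg => by
    change Representation.leftRegular ℚ _ (red p n g) m = m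
    rw [hg, map_one]
    rfl⟩

/-- The object `A(n)`, with value `ℚ[ℤ/p^n]` at all `k ≥ n` and at `∞`, value `0` at `k < n`,
and with the diagonal as structure map. -/
def gen (n : ℕ) : AlgModel p where
  left := genInf p n
  right := genFin p n
  hom := Rep.ofHom
    { toLinearMap := toTails (genFin p n) ∘ₗ
        (LinearMap.pi fun k => LinearMap.pi fun _ : PLift (n ≤ k) => LinearMap.id :
          QZ p n →ₗ[ℚ] (∀ k, genFin p n k))
      isIntertwining' := fun g => LinearMap.ext fun x => by
        refine congrArg (toTails (genFin p n)) (funext fun k => funext fun h => ?_)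
        change Representation.leftRegular ℚ _ (red p n g) x =
          Representation.leftRegular ℚ _ (proj p h.down (red p k g)) x
        rw [proj_red] }

/-! ### Tensor product of an object of `𝓐(ℤ_p)` with (complexes of) `ℚ`-modules -/

/-- `W ⊗_ℚ V` for a representation `W` and a `ℚ`-module `V`, with the action on the left factor,
as a functor of `V`. -/
def repTensor {G : Type} [Group G] (W : Rep.{0} ℚ G) : ModuleCat.{0} ℚ ⥤ Rep.{0} ℚ G where
  obj V := Rep.of (W.ρ.tprod (Representation.trivial ℚ G V))
  map f := Rep.ofHom
    { toLinearMap := f.hom.lTensor W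
      isIntertwining' := fun _ => TensorProduct.ext' fun _ _ => rfl }
  map_id _ := Rep.hom_ext (Representation.IntertwiningMap.ext (TensorProduct.ext' fun _ _ => rfl))
  map_comp _ _ :=
    Rep.hom_ext (Representation.IntertwiningMap.ext (TensorProduct.ext' fun _ _ => rfl))

instance {G : Type} [Group G] (W : Rep.{0} ℚ G) : (repTensor W).Additive where
  map_add {_ _ f g} := Rep.hom_ext (Representation.IntertwiningMap.ext
    (TensorProduct.ext' fun x y => TensorProduct.tmul_add x (f y) (g y)))

variable {p}

lemma isDiscrete_repTensor (W : DiscRep p) (V : ModuleCat.{0} ℚ) :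
    isDiscrete p ((repTensor W.obj).obj V) := by
  intro (m : W.obj ⊗[ℚ] V)
  change ∃ n : ℕ, ∀ g, red p n g = 1 →
    TensorProduct.map (W.obj.ρ g) (LinearMap.id : V →ₗ[ℚ] V) m = m
  induction m with
  | zero => exact ⟨0, fun g _ => map_zero _⟩
  | tmul w v =>
    obtain ⟨n, hn⟩ := W.property w
    exact ⟨n, fun g hg => by simp [hn g hg]⟩
  | add x y hx hy =>
    obtain ⟨n, hn⟩ := hx
    obtain ⟨m, hm⟩ := hy
    refine ⟨max n m, fun g hg => ?_⟩
    rw [map_add, hn g, hm g]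
    · rw [← proj_red p (le_max_right n m), hg, map_one]
    · rw [← proj_red p (le_max_left n m), hg, map_one]

/-- `(M_k) ↦ (M_k ⊗ V)`. -/
abbrev finTensor (M : FinPart p) (V : ModuleCat.{0} ℚ) : FinPart p :=
  fun k => (repTensor (M k)).obj V

/-- The bilinear map `((m_k), v) ↦ (m_k ⊗ v)`. -/
def seqTensor (M : FinPart p) (V : ModuleCat.{0} ℚ) :
    (∀ k, M k) →ₗ[ℚ] V →ₗ[ℚ] (∀ k, finTensor M V k) :=
  LinearMap.mk₂ ℚ (fun x v k => (x k ⊗ₜ[ℚ] v : M k ⊗[ℚ] V))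
    (fun _ _ _ => funext fun _ => TensorProduct.add_tmul _ _ _)
    (fun _ _ _ => funext fun _ => (TensorProduct.smul_tmul' _ _ _).symm)
    (fun _ _ _ => funext fun _ => TensorProduct.tmul_add _ _ _)
    (fun _ _ _ => funext fun _ => TensorProduct.tmul_smul _ _ _)

/-- The canonical map `tails(M) ⊗ V → tails(M ⊗ V)`, `[(m_k)] ⊗ v ↦ [(m_k ⊗ v)]`. -/
def tailsTensor (M : FinPart p) (V : ModuleCat.{0} ℚ) :
    (tailsObj M ⊗[ℚ] V) →ₗ[ℚ] tailsObj (finTensor M V) :=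
  TensorProduct.lift <| (eventuallyZero M).liftQ
    ((seqTensor M V).compr₂ (toTails (finTensor M V)))
    (by
      rintro x ⟨n, hn⟩
      refine LinearMap.ext fun v => ?_
      refine (Submodule.Quotient.mk_eq_zero _).2 ⟨n, fun k hk => ?_⟩
      change (x k ⊗ₜ[ℚ] v : M k ⊗[ℚ] V) = 0
      rw [hn k hk, TensorProduct.zero_tmul])

lemma tailsTensor_tmul (M : FinPart p) (V : ModuleCat.{0} ℚ) (x : ∀ k, M k) (v : V) :
    tailsTensor M V (toTails M x ⊗ₜ v) =
      toTails (finTensor M V) (seqTensor M V x v) := rfl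

lemma toTails_surjective (M : FinPart p) : Function.Surjective (toTails M) :=
  Submodule.mkQ_surjective _

/-- The structure map `M_∞ ⊗ V → tails(M) ⊗ V → tails(M ⊗ V)` of `M ⊗ V`. -/
def tensorStr (M : AlgModel p) (V : ModuleCat.{0} ℚ) :
    (repTensor M.left.obj).obj V ⟶ (tails p).obj (finTensor M.right V) :=
  Rep.ofHom
    { toLinearMap := tailsTensor M.right V ∘ₗ M.hom.hom.toLinearMap.rTensor V
      isIntertwining' := fun g => TensorProduct.ext' fun m v => by
        obtain ⟨x, hx⟩ := toTails_surjective M.right (M.hom.hom.toLinearMap m)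
        have h : M.hom.hom.toLinearMap (M.left.obj.ρ g m) =
            toTails M.right (seqRep M.right g x) := by
          refine (Rep.hom_comm_apply M.hom g m).trans ?_
          exact (congrArg ((tailsObj M.right).ρ g) hx.symm).trans rfl
        change tailsTensor M.right V (M.hom.hom.toLinearMap (M.left.obj.ρ g m) ⊗ₜ v) =
          (tailsObj _).ρ g (tailsTensor M.right V (M.hom.hom.toLinearMap m ⊗ₜ v))
        rw [h, ← hx]
        rfl }

lemma tensorStr_naturality (M : AlgModel p) {V V' : ModuleCat.{0} ℚ} (f : V ⟶ V') :
    (repTensor M.left.obj).map f ≫ tensorStr M V' =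
      tensorStr M V ≫ (tails p).map (X := finTensor M.right V) (Y := finTensor M.right V')
        (fun k => (repTensor (M.right k)).map f) := by
  refine Rep.hom_ext (Representation.IntertwiningMap.ext (TensorProduct.ext' fun m v => ?_))
  obtain ⟨x, hx⟩ := toTails_surjective M.right (M.hom.hom.toLinearMap m)
  change tailsTensor M.right V' (M.hom.hom.toLinearMap m ⊗ₜ f.hom v) =
    ((tails p).map (X := finTensor M.right V) (Y := finTensor M.right V')
      (fun k => (repTensor (M.right k)).map f)).hom.toLinearMap
      (tailsTensor M.right V (M.hom.hom.toLinearMap m ⊗ₜ v))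
  rw [← hx]
  rfl

/-- The functor `V ↦ M ⊗ V` from `ℚ`-modules to `𝓐(ℤ_p)`, with `(M ⊗ V)_k = M_k ⊗ V` and
`(M ⊗ V)_∞ = M_∞ ⊗ V`. -/
def tensor (M : AlgModel p) : ModuleCat.{0} ℚ ⥤ AlgModel p where
  obj V :=
    { left := ⟨(repTensor M.left.obj).obj V, isDiscrete_repTensor M.left V⟩
      right := finTensor M.right V
      hom := tensorStr M V }
  map f :=
    { left := ObjectProperty.homMk ((repTensor M.left.obj).map f)
      right := fun k => (repTensor (M.right k)).map f
      w := tensorStr_naturality M f }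
  map_id V := by
    refine CommaMorphism.ext (ObjectProperty.hom_ext _ ?_) (funext fun k => ?_)
    · exact (repTensor M.left.obj).map_id V
    · exact (repTensor (M.right k)).map_id V
  map_comp f g := by
    refine CommaMorphism.ext (ObjectProperty.hom_ext _ ?_) (funext fun k => ?_)
    · exact (repTensor M.left.obj).map_comp f g
    · exact (repTensor (M.right k)).map_comp f g

instance (M : AlgModel p) : (tensor M).Additive where
  map_add := by
    refine CommaMorphism.ext (ObjectProperty.hom_ext _ ?_) (funext fun k => ?_)
    · exact (repTensor M.left.obj).map_add
    · exact (repTensor (M.right k)).map_add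

/-- The functor `X ↦ M ⊗ X` from `dg ℚ`-modules to `dg 𝓐(ℤ_p)`. -/
abbrev dgTensor (M : AlgModel p) : ChainComplex (ModuleCat.{0} ℚ) ℤ ⥤ DGAlgModel p :=
  (tensor M).mapHomologicalComplex _

/-! ### The generating sets -/

/-- The sphere complex `S^m`: `ℚ` in degree `m` and `0` elsewhere. -/
abbrev sphere (m : ℤ) : ChainComplex (ModuleCat.{0} ℚ) ℤ :=
  (HomologicalComplex.single (ModuleCat.{0} ℚ) (ComplexShape.down ℤ) m).obj (ModuleCat.of ℚ ℚ)

lemma rel_succ (m : ℤ) : (ComplexShape.down ℤ).Rel (m + 1) m := rfl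

/-- The disk complex `D^{m+1}`: `ℚ` in degrees `m + 1` and `m`, with identity differential. -/
abbrev disk (m : ℤ) : ChainComplex (ModuleCat.{0} ℚ) ℤ :=
  HomologicalComplex.double (c := ComplexShape.down ℤ) (i₀ := m + 1) (i₁ := m)
    (𝟙 (ModuleCat.of ℚ ℚ)) (rel_succ m)

/-- The inclusion `S^m → D^{m+1}`, the identity in degree `m`. -/
def sphereToDisk (m : ℤ) : sphere m ⟶ disk m :=
  HomologicalComplex.mkHomFromSingle
    (HomologicalComplex.doubleXIso₁ (𝟙 (ModuleCat.of ℚ ℚ)) (rel_succ m) (by omega)).inv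
    (fun k _ => by
      rw [HomologicalComplex.double_d_eq_zero₀ _ _ _ _ (by omega), comp_zero])

/-- The generating acyclic cofibration `0 → D^{m+1}`. -/
def zeroToDisk (m : ℤ) : (0 : ChainComplex (ModuleCat.{0} ℚ) ℤ) ⟶ disk m := 0

variable (p)

/-- The set `A(n) ⊗ I`, where `n ≥ 0` and `I = {S^m → D^{m+1}}` is the set of generating
cofibrations of `dg ℚ`-modules. -/
def genCof : MorphismProperty (DGAlgModel p) :=
  MorphismProperty.ofHoms fun x : ℕ × ℤ => (dgTensor (gen p x.1)).map (sphereToDisk x.2)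

/-- The set `A(n) ⊗ J`, where `n ≥ 0` and `J = {0 → D^{m+1}}` is the set of generating acyclic
cofibrations of `dg ℚ`-modules. -/
def genAcyclicCof : MorphismProperty (DGAlgModel p) :=
  MorphismProperty.ofHoms fun x : ℕ × ℤ => (dgTensor (gen p x.1)).map (zeroToDisk x.2)

end

end

end ZpModel

namespace ZpModel

noncomputable section

/-! ### Elementwise description of morphisms in `𝓐(ℤ_p)` -/

section Elements

variable {p : ℕ} [Fact p.Prime]

/-! A map A(n) → M amounts to a vector a of M_∞ fixed by p^n ℤ_p and vectors x_k of M_k, k ≥ n,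
fixed by p^n, such that the sequence (x_k) represents the image of a under the structure map
(`isGenDatum_of_hom`, `gen_hom_ext`, `exists_gen_hom`). Over ℚ, invariant lifts are obtained by
averaging over finite orbits, and changing finitely many x_k does not change the germ, so lifts
found independently at ∞ and at each k can be patched. Hence A(n) is projective for pointwise exact
sequences (`PointwiseExact.exists_lift`). Conversely every element of M_∞ or M_k is the image of a
canonical generator of some A(n). So exactness at all k and at ∞ is the same as exactness of
Hom(A(n), -) for all n (`exact_map_ev_iff`).

Lifting f : X → Y against A(n) ⊗ (S^m → D^{m+1}) means exactness of Hom(A(n), -) on X_{m+1} → X_m ⊕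
Y_{m+1} → X_{m-1} ⊕ Y_m. Pointwise exactness of these complexes for all m says that f is a
surjective homology isomorphism (`rlp_genCof_iff`). Lifting against disks is surjectivity
(`rlp_genAcyclicCof_iff`). The patching principle also makes A(n) finitely presentable, so the small
object argument runs with ℵ₀.

A map f : X → Y with the left lifting property against fibrations is a retract of X → X ⊕ cone, with
contractible cone, hence a homology isomorphism (`isHomologyIso_of_llp`). The usual retract argument
then identifies these maps with the acyclic cofibrations. For properness, cofibrations are
degreewise split (`exists_retraction_of_llp`), evaluation takes pushouts and pullbacks in 𝓐(ℤ_p) to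
those of vector spaces, and element chases finish. Limits exist because discrete modules are
coreflective among all ℤ_p-modules. -/

/-- The linear map underlying the value of a morphism at `∞`. -/
def atInf {M N : AlgModel p} (f : M ⟶ N) : M.left.obj →ₗ[ℚ] N.left.obj :=
  f.left.hom.hom.toLinearMap

/-- The linear map underlying the value of a morphism at `k`. -/
def atFin {M N : AlgModel p} (f : M ⟶ N) (k : ℕ) : M.right k →ₗ[ℚ] N.right k :=
  (f.right k).hom.toLinearMap

/-- The linear map underlying the structure map. -/
def strMap (M : AlgModel p) : M.left.obj →ₗ[ℚ] tailsObj M.right :=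
  M.hom.hom.toLinearMap

lemma atInf_comp {M N P : AlgModel p} (f : M ⟶ N) (g : N ⟶ P) (a : M.left.obj) :
    atInf (f ≫ g) a = atInf g (atInf f a) := rfl

lemma atFin_comp {M N P : AlgModel p} (f : M ⟶ N) (g : N ⟶ P) (k : ℕ) (x : M.right k) :
    atFin (f ≫ g) k x = atFin g k (atFin f k x) := rfl

lemma atFin_zero {M N : AlgModel p} (k : ℕ) (x : M.right k) :
    atFin (0 : M ⟶ N) k x = 0 := rfl

lemma atInf_ρ {M N : AlgModel p} (f : M ⟶ N) (g : Multiplicative ℤ_[p]) (a : M.left.obj) :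
    atInf f (M.left.obj.ρ g a) = N.left.obj.ρ g (atInf f a) :=
  Rep.hom_comm_apply f.left.hom g a

lemma atFin_ρ {M N : AlgModel p} (f : M ⟶ N) (k : ℕ) (g : Multiplicative (ZMod (p ^ k)))
    (x : M.right k) : atFin f k ((M.right k).ρ g x) = (N.right k).ρ g (atFin f k x) :=
  Rep.hom_comm_apply (f.right k) g x

lemma algModel_hom_ext {M N : AlgModel p} {f g : M ⟶ N} (h : ∀ a, atInf f a = atInf g a)
    (h' : ∀ k x, atFin f k x = atFin g k x) : f = g := by
  refine CommaMorphism.ext (ObjectProperty.hom_ext _ ?_) (funext fun k => ?_)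
  · exact Rep.hom_ext (Representation.IntertwiningMap.ext (LinearMap.ext h))
  · exact Rep.hom_ext (Representation.IntertwiningMap.ext (LinearMap.ext (h' k)))

lemma toTails_eq_iff {M : FinPart p} {x y : ∀ k, M k} :
    toTails M x = toTails M y ↔ ∃ n, ∀ k, n ≤ k → x k = y k := by
  refine (Submodule.Quotient.eq _).trans ⟨?_, ?_⟩
  · rintro ⟨n, hn⟩
    exact ⟨n, fun k hk => sub_eq_zero.1 (hn k hk)⟩
  · rintro ⟨n, hn⟩
    exact ⟨n, fun k hk => sub_eq_zero.2 (hn k hk)⟩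

lemma toTails_eq_zero_iff {M : FinPart p} {x : ∀ k, M k} :
    toTails M x = 0 ↔ ∃ n, ∀ k, n ≤ k → x k = 0 :=
  Submodule.Quotient.mk_eq_zero _

/-- The compatibility square of a morphism, in the form used below: germs are always handled through
a chosen representing sequence. -/
lemma strMap_atInf {M N : AlgModel p} (f : M ⟶ N) {a : M.left.obj} {x : ∀ k, M.right k}
    (h : strMap M a = toTails M.right x) :
    strMap N (atInf f a) = toTails N.right (fun k => atFin f k (x k)) := by
  have := congrArg (fun φ => φ.hom.toLinearMap a) f.w
  refine this.trans ?_
  change ((tails p).map f.right).hom.toLinearMap (strMap M a) = _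
  rw [h]
  rfl

lemma strMap_ρ {M : AlgModel p} {a : M.left.obj} {x : ∀ k, M.right k}
    (h : strMap M a = toTails M.right x) (g : Multiplicative ℤ_[p]) :
    strMap M (M.left.obj.ρ g a) = toTails M.right (fun k => (M.right k).ρ (red p k g) (x k)) := by
  refine (Rep.hom_comm_apply M.hom g a).trans ?_
  change (tailsObj M.right).ρ g (strMap M a) = _
  rw [h]
  rfl

/-- Constructor for morphisms in terms of linear maps. -/
lemma exists_algModel_hom {M N : AlgModel p} (f : M.left.obj ⟶ N.left.obj)
    (f' : ∀ k, M.right k ⟶ N.right k)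
    (h : ∀ a, ∃ x, strMap M a = toTails M.right x ∧
      strMap N (f.hom a) = toTails N.right (fun k => (f' k).hom (x k))) :
    ∃ φ : M ⟶ N, (∀ a, atInf φ a = f.hom a) ∧ ∀ k x, atFin φ k x = (f' k).hom x := by
  refine ⟨{ left := ObjectProperty.homMk f, right := f', w := ?_ }, fun _ => rfl, fun _ _ => rfl⟩
  refine Rep.hom_ext (Representation.IntertwiningMap.ext (LinearMap.ext fun a => ?_))
  obtain ⟨x, hx, hx'⟩ := h a
  refine hx'.trans ?_
  change _ = ((tails p).map f').hom.toLinearMap (strMap M a)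
  rw [hx]
  rfl

end Elements

/-! ### Fixed vectors and averaging -/

section Averaging

/-- In characteristic zero, a solution of `f z = y` with `y` invariant and `z` of finite order
can be averaged to an invariant solution. -/
lemma exists_fixed_of_pow_fixed {V : Type*} [AddCommGroup V] [Module ℚ V]
    (T : V →ₗ[ℚ] V) {N : ℕ} (hN : 0 < N) {z : V} (hz : (T ^ N) z = z) :
    ∃ z' : V, T z' = z' ∧ ∀ {W : Type} [AddCommGroup W] [Module ℚ W] (S : W →ₗ[ℚ] W)
      (f : V →ₗ[ℚ] W), (∀ v, f (T v) = S (f v)) → S (f z) = f z → f z' = f z := by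
  refine ⟨(N : ℚ)⁻¹ • ∑ c ∈ Finset.range N, (T ^ c) z, ?_, ?_⟩
  · rw [map_smul, map_sum]
    congr 1
    have h1 : ∀ c, T ((T ^ c) z) = (T ^ (c + 1)) z := fun c => by
      rw [pow_succ']; rfl
    simp only [h1]
    -- Splitting off the last and the first term of the sum over `range (N + 1)`, which agree since
    -- `T ^ N` fixes `z`, shows that applying `T` permutes the summands.
    have h2 := Finset.sum_range_succ (fun c => (T ^ c) z) N
    have h3 := Finset.sum_range_succ' (fun c => (T ^ c) z) N
    rw [h2] at h3
    simp only [pow_zero, hz, Module.End.one_apply] at h3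
    exact (add_right_cancel h3).symm
  · intro W _ _ S f hf hS
    have h1 : ∀ c, f ((T ^ c) z) = f z := by
      intro c
      induction c with
      | zero => rfl
      | succ c ih => rw [pow_succ', Module.End.mul_apply, hf, ih, hS]
    have hN' : (N : ℚ) ≠ 0 := by exact_mod_cast hN.ne'
    rw [map_smul, map_sum, Finset.sum_congr rfl fun c _ => h1 c, Finset.sum_const,
      Finset.card_range, ← Nat.cast_smul_eq_nsmul ℚ, smul_smul, inv_mul_cancel₀ hN', one_smul]

variable (p : ℕ) [Fact p.Prime]

/-- The topological generator `p ^ n` of the subgroup `p ^ n ℤ_p`. -/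
def topGen (n : ℕ) : Multiplicative ℤ_[p] := Multiplicative.ofAdd ((p : ℤ_[p]) ^ n)

variable {p}

lemma red_topGen (n k : ℕ) :
    red p k (topGen p n) = Multiplicative.ofAdd ((p : ZMod (p ^ k)) ^ n) := by
  change Multiplicative.ofAdd (PadicInt.toZModPow k ((p : ℤ_[p]) ^ n)) = _
  rw [map_pow, map_natCast]

lemma red_topGen_eq_one {n k : ℕ} (h : k ≤ n) : red p k (topGen p n) = 1 := by
  rw [red_topGen, ← Nat.cast_pow, (ZMod.natCast_eq_zero_iff _ _).2 (pow_dvd_pow p h)]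
  rfl

lemma red_surjective (k : ℕ) : Function.Surjective (red p k) := by
  intro g
  have : NeZero (p ^ k) := ⟨pow_ne_zero _ (Fact.out : p.Prime).ne_zero⟩
  refine ⟨Multiplicative.ofAdd ((ZMod.val g.toAdd : ℕ) : ℤ_[p]), ?_⟩
  change Multiplicative.ofAdd (PadicInt.toZModPow k ((ZMod.val g.toAdd : ℕ) : ℤ_[p])) = g
  rw [map_natCast, ZMod.natCast_zmod_val]
  rfl

lemma proj_surjective {n k : ℕ} (h : n ≤ k) : Function.Surjective (proj p h) := by
  intro g
  obtain ⟨g', rfl⟩ := red_surjective n g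
  exact ⟨red p k g', proj_red p h g'⟩

/-- The kernel of ℤ/p^k → ℤ/p^n is cyclic, generated by the class of p^n. Invariance under a whole
subgroup thereby becomes one equation for one operator, to which averaging applies. -/
lemma exists_red_topGen_pow {n k : ℕ} (h : n ≤ k) {g : Multiplicative (ZMod (p ^ k))}
    (hg : proj p h g = 1) : ∃ c : ℕ, g = red p k (topGen p n) ^ c := by
  have : NeZero (p ^ k) := ⟨pow_ne_zero _ (Fact.out : p.Prime).ne_zero⟩
  have h1 : ((ZMod.val g.toAdd : ℕ) : ZMod (p ^ n)) = 0 := by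
    have h2 : ZMod.castHom (pow_dvd_pow p h) (ZMod (p ^ n)) g.toAdd = 0 := hg
    rw [← ZMod.natCast_zmod_val g.toAdd, map_natCast] at h2
    exact h2
  obtain ⟨c, hc⟩ := (ZMod.natCast_eq_zero_iff _ _).1 h1
  refine ⟨c, ?_⟩
  rw [red_topGen, ← ofAdd_nsmul]
  change Multiplicative.ofAdd g.toAdd = _
  rw [← ZMod.natCast_zmod_val g.toAdd, hc]
  push_cast
  rw [nsmul_eq_mul, mul_comm]

lemma fixed_fin_of_topGen {n k : ℕ} (h : n ≤ k) {W : Rep.{0} ℚ (Multiplicative (ZMod (p ^ k)))}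
    {x : W} (hx : W.ρ (red p k (topGen p n)) x = x) (g : Multiplicative (ZMod (p ^ k)))
    (hg : proj p h g = 1) : W.ρ g x = x := by
  obtain ⟨c, rfl⟩ := exists_red_topGen_pow h hg
  clear hg
  rw [map_pow]
  induction c with
  | zero => rfl
  | succ c ih => rw [pow_succ', Module.End.mul_apply, ih, hx]

/-- The powers of `topGen p n` are only dense in p^n ℤ_p. By discreteness some p^m ℤ_p fixes `a`,
and modulo it g agrees with a power of the generator. -/
lemma fixed_inf_of_topGen {n : ℕ} {W : DiscRep p} {a : W.obj}
    (ha : W.obj.ρ (topGen p n) a = a) (g : Multiplicative ℤ_[p]) (hg : red p n g = 1) :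
    W.obj.ρ g a = a := by
  obtain ⟨m, hm⟩ := W.property a
  obtain ⟨c, hc⟩ := exists_red_topGen_pow (le_max_left n m) (g := red p (max n m) g)
    (by rw [proj_red, hg])
  have h1 : red p m ((topGen p n ^ c)⁻¹ * g) = 1 := by
    rw [← proj_red p (le_max_right n m), map_mul, hc, map_inv, map_pow, inv_mul_cancel, map_one]
  have h2 : ∀ c : ℕ, W.obj.ρ (topGen p n ^ c) a = a := by
    intro c
    rw [map_pow]
    induction c with
    | zero => rfl
    | succ c ih => rw [pow_succ', Module.End.mul_apply, ih, ha]
  have h3 : g = topGen p n ^ c * ((topGen p n ^ c)⁻¹ * g) := by group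
  rw [h3, map_mul, Module.End.mul_apply, hm _ h1, h2]

lemma exists_topGen_fixed (W : DiscRep p) (a : W.obj) :
    ∃ n, W.obj.ρ (topGen p n) a = a := by
  obtain ⟨n, hn⟩ := W.property a
  exact ⟨n, hn _ (red_topGen_eq_one le_rfl)⟩

lemma pow_prime_pos (k : ℕ) : 0 < p ^ k := pow_pos (Fact.out : p.Prime).pos _

omit [Fact p.Prime] in
lemma fin_ρ_pow_fixed {k : ℕ} (W : Rep.{0} ℚ (Multiplicative (ZMod (p ^ k))))
    (g : Multiplicative (ZMod (p ^ k))) (x : W) : (W.ρ g ^ p ^ k) x = x := by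
  rw [← map_pow]
  have : g ^ p ^ k = 1 := by
    change Multiplicative.ofAdd ((p ^ k) • g.toAdd) = _
    rw [nsmul_eq_mul, ZMod.natCast_self, zero_mul]
    rfl
  rw [this, map_one]
  rfl

/-- Discreteness gives finite orbits, so averaging is available at ∞ too; the period N depends on
`a`. -/
lemma inf_ρ_pow_fixed (W : DiscRep p) (g : Multiplicative ℤ_[p]) (a : W.obj) :
    ∃ N, 0 < N ∧ (W.obj.ρ g ^ N) a = a := by
  obtain ⟨n, hn⟩ := W.property a
  refine ⟨p ^ n, pow_prime_pos n, ?_⟩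
  rw [← map_pow]
  refine hn _ ?_
  rw [map_pow]
  change Multiplicative.ofAdd ((p ^ n) • (red p n g).toAdd) = _
  rw [nsmul_eq_mul, ZMod.natCast_self, zero_mul]
  rfl

end Averaging

/-! ### Morphisms out of `A(n)` -/

section GenHom

/-- A vector fixed by the kernel of a surjective group homomorphism `π : G → H` gives
a morphism from the regular representation of `H`. -/
lemma exists_hom_leftRegular {G H : Type} [Group G] [Group H] (π : G →* H)
    (hπ : Function.Surjective π) (W : Rep.{0} ℚ G) (a : W) (ha : ∀ g, π g = 1 → W.ρ g a = a) :
    ∃ f : Rep.of ((Representation.leftRegular ℚ H).comp π) ⟶ W,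
      f.hom (MonoidAlgebra.single 1 1) = a := by
  -- A set-theoretic section is enough: by `key`, the vector `W.ρ g a` depends only on `π g`.
  choose s hs using hπ
  have key : ∀ g h, π g = π h → W.ρ g a = W.ρ h a := by
    intro g h hgh
    have h1 : g = h * (h⁻¹ * g) := by group
    rw [h1, map_mul, Module.End.mul_apply, ha]
    rw [map_mul, map_inv, hgh, inv_mul_cancel]
  let f : MonoidAlgebra ℚ H →ₗ[ℚ] W := Finsupp.lift W ℚ H (fun h => W.ρ (s h) a) ∘ₗ
    (MonoidAlgebra.coeffLinearEquiv ℚ).toLinearMap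
  have hf : ∀ h, f (MonoidAlgebra.single h 1) = W.ρ (s h) a := fun h => by
    simp [f]
  refine ⟨Rep.ofHom { toLinearMap := f, isIntertwining' := fun g => ?_ }, ?_⟩
  · refine MonoidAlgebra.lhom_ext' fun h => LinearMap.ext_ring ?_
    change f (Representation.leftRegular ℚ H (π g) (MonoidAlgebra.single h 1)) =
      W.ρ g (f (MonoidAlgebra.single h 1))
    rw [Representation.ofMulAction_single]
    rw [hf, hf, ← Module.End.mul_apply, ← map_mul]
    exact key _ _ (by simp [hs])
  · refine (hf 1).trans ?_
    exact ha _ (hs 1)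

end GenHom

section GenHomData

variable {p : ℕ} [Fact p.Prime]

/-- The canonical generator of `A(n)_∞ = ℚ[ℤ/p^n]`. -/
def genOneInf (p : ℕ) [Fact p.Prime] (n : ℕ) : (gen p n).left.obj :=
  (MonoidAlgebra.single 1 1 : QZ p n)

/-- The canonical generator of `A(n)_k`. -/
def genOneFin (p : ℕ) [Fact p.Prime] (n k : ℕ) : (gen p n).right k :=
  (fun _ => MonoidAlgebra.single 1 1 : PLift (n ≤ k) → QZ p n)

/-- The conditions satisfied by the images of the canonical generators under a map
`A(n) → M`. -/
structure IsGenDatum (n : ℕ) {M : AlgModel p} (a : M.left.obj) (x : ∀ k, M.right k) : Prop where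
  inf : M.left.obj.ρ (topGen p n) a = a
  fin (k : ℕ) : (M.right k).ρ (red p k (topGen p n)) (x k) = x k
  str : strMap M a = toTails M.right x

lemma strMap_gen (n : ℕ) (a : QZ p n) :
    strMap (gen p n) a = toTails (gen p n).right (fun _ _ => a) := rfl

lemma genOneInf_ρ (n : ℕ) (g : Multiplicative ℤ_[p]) :
    (gen p n).left.obj.ρ g (genOneInf p n) = (MonoidAlgebra.single (red p n g) 1 : QZ p n) := by
  refine (Representation.ofMulAction_single (k := ℚ) (red p n g) (1 : Multiplicative (ZMod (p ^ n)))
    1).trans ?_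
  rw [smul_eq_mul, mul_one]

lemma genOneFin_ρ (n k : ℕ) (g : Multiplicative (ZMod (p ^ k))) :
    ((gen p n).right k).ρ g (genOneFin p n k) =
      (fun h => MonoidAlgebra.single (proj p h.down g) 1 : PLift (n ≤ k) → QZ p n) := by
  funext h
  refine (Representation.ofMulAction_single (k := ℚ) (proj p h.down g)
    (1 : Multiplicative (ZMod (p ^ n))) 1).trans ?_
  rw [smul_eq_mul, mul_one]

/-- The generators themselves satisfy the conditions because p^n vanishes in ℤ/p^n, and morphisms
preserve them. -/
lemma isGenDatum_of_hom {n : ℕ} {M : AlgModel p} (φ : gen p n ⟶ M) :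
    IsGenDatum n (atInf φ (genOneInf p n)) (fun k => atFin φ k (genOneFin p n k)) where
  inf := by
    rw [← atInf_ρ, genOneInf_ρ, red_topGen_eq_one le_rfl]
    rfl
  fin k := by
    rw [← atFin_ρ, genOneFin_ρ]
    congr 1
    funext h
    rw [proj_red, red_topGen_eq_one le_rfl]
    rfl
  str := strMap_atInf φ (strMap_gen n _)

/-- The group translates of the canonical generators span. Nothing is required for k < n, where
A(n)_k is zero. -/
lemma gen_hom_ext {n : ℕ} {M : AlgModel p} {φ ψ : gen p n ⟶ M}
    (h : atInf φ (genOneInf p n) = atInf ψ (genOneInf p n))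
    (h' : ∀ k, n ≤ k → atFin φ k (genOneFin p n k) = atFin ψ k (genOneFin p n k)) : φ = ψ := by
  refine algModel_hom_ext (fun a => ?_) (fun k x => ?_)
  · refine LinearMap.congr_fun (f := (atInf φ : QZ p n →ₗ[ℚ] _)) (g := atInf ψ) ?_ a
    refine MonoidAlgebra.lhom_ext' fun g => LinearMap.ext_ring ?_
    obtain ⟨g, rfl⟩ := red_surjective n g
    change atInf φ (MonoidAlgebra.single (red p n g) 1 : QZ p n) =
      atInf ψ (MonoidAlgebra.single (red p n g) 1 : QZ p n)
    rw [← genOneInf_ρ, atInf_ρ, atInf_ρ, h]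
  · by_cases hk : n ≤ k
    · let c : QZ p n →ₗ[ℚ] (gen p n).right k :=
        (LinearMap.pi fun _ => LinearMap.id : QZ p n →ₗ[ℚ] (PLift (n ≤ k) → QZ p n))
      have hx : x = c ((x : PLift (n ≤ k) → QZ p n) ⟨hk⟩) := rfl
      rw [hx]
      refine LinearMap.congr_fun (f := atFin φ k ∘ₗ c) (g := atFin ψ k ∘ₗ c) ?_ _
      refine MonoidAlgebra.lhom_ext' fun g => LinearMap.ext_ring ?_
      obtain ⟨g, rfl⟩ := proj_surjective hk g
      have hg : c (MonoidAlgebra.single (proj p hk g) 1) =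
          ((gen p n).right k).ρ g (genOneFin p n k) := (genOneFin_ρ n k g).symm
      change atFin φ k (c (MonoidAlgebra.single (proj p hk g) 1)) =
        atFin ψ k (c (MonoidAlgebra.single (proj p hk g) 1))
      rw [hg, atFin_ρ, atFin_ρ, h' k hk]
    · have hx : x = 0 := funext fun h => (hk h.down).elim
      rw [hx, map_zero, map_zero]

/-- Evaluation `A(n)_k → ℚ[ℤ/p^n]` for `n ≤ k`. -/
def genFinEval {n k : ℕ} (h : n ≤ k) : (gen p n).right k ⟶
    Rep.of ((Representation.leftRegular ℚ (Multiplicative (ZMod (p ^ n)))).comp (proj p h)) :=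
  Rep.ofHom
    { toLinearMap := (LinearMap.proj (⟨h⟩ : PLift (n ≤ k)) : (PLift (n ≤ k) → QZ p n) →ₗ[ℚ] QZ p n)
      isIntertwining' := fun _ => rfl }

/-- The values of A(n) at ∞ and at k ≥ n are regular representations of ℤ/p^n, so fixed vectors
define the components one at a time. Compatibility with the structure maps is then an equality of
germs, checked on translates of the generator. -/
lemma exists_gen_hom {n : ℕ} {M : AlgModel p} {a : M.left.obj} {x : ∀ k, M.right k}
    (hax : IsGenDatum n a x) : ∃ φ : gen p n ⟶ M, atInf φ (genOneInf p n) = a ∧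
      ∀ k, n ≤ k → atFin φ k (genOneFin p n k) = x k := by
  obtain ⟨f, hf⟩ := exists_hom_leftRegular (red p n) (red_surjective n) M.left.obj a
    (fixed_inf_of_topGen hax.inf)
  have hfin : ∀ k, ∃ f' : (gen p n).right k ⟶ M.right k,
      n ≤ k → f'.hom (genOneFin p n k) = x k := by
    intro k
    by_cases hk : n ≤ k
    · obtain ⟨f', hf'⟩ := exists_hom_leftRegular (proj p hk) (proj_surjective hk) (M.right k) (x k)
        (fixed_fin_of_topGen hk (hax.fin k))
      exact ⟨genFinEval hk ≫ f', fun _ => hf'⟩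
    · exact ⟨0, fun h => (hk h).elim⟩
  choose f' hf' using hfin
  suffices H : ∀ b : QZ p n, strMap M (f.hom b) = toTails M.right
      (fun k => (f' k).hom (fun _ => b : PLift (n ≤ k) → QZ p n)) by
    obtain ⟨φ, hφ, hφ'⟩ := exists_algModel_hom f f' (fun b => ⟨fun _ _ => b, rfl, H b⟩)
    exact ⟨φ, (hφ _).trans hf, fun k hk => (hφ' k _).trans (hf' k hk)⟩
  intro b
  let c : QZ p n →ₗ[ℚ] (∀ k, M.right k) := LinearMap.pi fun k => (f' k).hom.toLinearMap ∘ₗ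
    (LinearMap.pi fun _ => LinearMap.id : QZ p n →ₗ[ℚ] (PLift (n ≤ k) → QZ p n))
  refine LinearMap.congr_fun (f := (strMap M ∘ₗ f.hom.toLinearMap : QZ p n →ₗ[ℚ] _))
    (g := toTails M.right ∘ₗ c) ?_ b
  refine MonoidAlgebra.lhom_ext' fun g => LinearMap.ext_ring ?_
  obtain ⟨g, rfl⟩ := red_surjective n g
  change strMap M (f.hom.toLinearMap (MonoidAlgebra.single (red p n g) 1 : QZ p n)) =
    toTails M.right (c (MonoidAlgebra.single (red p n g) 1 : QZ p n))
  have h1 : f.hom.toLinearMap (MonoidAlgebra.single (red p n g) 1 : QZ p n) =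
      M.left.obj.ρ g a := by
    rw [← genOneInf_ρ, ← hf]
    exact Rep.hom_comm_apply f g _
  rw [h1, strMap_ρ hax.str]
  -- For k < n the component is zero and need not match `x k`; the germ does not see these indices.
  refine toTails_eq_iff.2 ⟨n, fun k hk => ?_⟩
  rw [← hf' k hk]
  refine (Rep.hom_comm_apply (f' k) _ _).symm.trans ?_
  refine congrArg (f' k).hom ((genOneFin_ρ n k _).trans ?_)
  funext h
  rw [proj_red]
  rfl

end GenHomData

/-! ### The objects `A(n)` are projective and generate -/

section Exactness

variable {p : ℕ} [Fact p.Prime]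

/-- Exactness of `M → N → P` at all `k` and at `∞`. -/
structure PointwiseExact (S : ShortComplex (AlgModel p)) : Prop where
  inf (b : S.X₂.left.obj) : atInf S.g b = 0 → ∃ a, atInf S.f a = b
  fin (k : ℕ) (y : S.X₂.right k) : atFin S.g k y = 0 → ∃ x, atFin S.f k x = y

lemma exists_strMap_eq (M : AlgModel p) (a : M.left.obj) :
    ∃ x, strMap M a = toTails M.right x := by
  obtain ⟨x, hx⟩ := toTails_surjective M.right (strMap M a)
  exact ⟨x, hx.symm⟩

/-- Equivariance of the structure map only says that `x` and its translate have the same germ,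
whence invariance from some index on. -/
lemma exists_fixed_tail {M : AlgModel p} {a : M.left.obj} {x : ∀ k, M.right k}
    (h : strMap M a = toTails M.right x) {g : Multiplicative ℤ_[p]}
    (hg : M.left.obj.ρ g a = a) :
    ∃ K, ∀ k, K ≤ k → (M.right k).ρ (red p k g) (x k) = x k := by
  have := strMap_ρ h g
  rw [hg, h] at this
  obtain ⟨K, hK⟩ := toTails_eq_iff.1 this
  exact ⟨K, fun k hk => (hK k hk).symm⟩

/-- Projectivity of A(n). Averaging gives an invariant preimage `a` at ∞ and invariant preimages `z
k` at each k, unrelated to each other. A sequence `w` representing the germ of `a` is invariant and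
lifts `y` for large k. Taking `w` for large k and `z` for the finitely many others yields a
compatible datum. -/
lemma PointwiseExact.exists_lift {S : ShortComplex (AlgModel p)} (hS : PointwiseExact S) {n : ℕ}
    (φ : gen p n ⟶ S.X₂) (hφ : φ ≫ S.g = 0) : ∃ ψ : gen p n ⟶ S.X₁, ψ ≫ S.f = φ := by
  obtain ⟨h₁, h₂, h₃⟩ := isGenDatum_of_hom φ
  set b := atInf φ (genOneInf p n)
  set y := fun k => atFin φ k (genOneFin p n k)
  have hb : atInf S.g b = 0 := by rw [← atInf_comp, hφ]; rfl
  have hy : ∀ k, atFin S.g k (y k) = 0 := fun k => by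
    change atFin S.g k (atFin φ k (genOneFin p n k)) = 0
    rw [← atFin_comp, hφ]; rfl
  obtain ⟨a, ha, hab⟩ : ∃ a, S.X₁.left.obj.ρ (topGen p n) a = a ∧ atInf S.f a = b := by
    obtain ⟨a, ha⟩ := hS.inf b hb
    obtain ⟨N, hN, hN'⟩ := inf_ρ_pow_fixed S.X₁.left (topGen p n) a
    obtain ⟨a', h, h'⟩ := exists_fixed_of_pow_fixed _ hN hN'
    refine ⟨a', h, (h' (S.X₂.left.obj.ρ (topGen p n)) (atInf S.f) (atInf_ρ S.f _) ?_).trans ha⟩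
    rw [ha, h₁]
  have hfin : ∀ k, ∃ x, (S.X₁.right k).ρ (red p k (topGen p n)) x = x ∧ atFin S.f k x = y k := by
    intro k
    obtain ⟨x, hx⟩ := hS.fin k (y k) (hy k)
    obtain ⟨x', h, h'⟩ := exists_fixed_of_pow_fixed _ (pow_prime_pos k)
      (fin_ρ_pow_fixed (S.X₁.right k) (red p k (topGen p n)) x)
    refine ⟨x', h, (h' ((S.X₂.right k).ρ _) (atFin S.f k) (atFin_ρ S.f k _) ?_).trans hx⟩
    rw [hx, h₂]
  choose z hz hzy using hfin
  obtain ⟨w, hw⟩ := exists_strMap_eq _ a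
  obtain ⟨K₁, hK₁⟩ := exists_fixed_tail hw ha
  -- The image of `w` and the sequence `y` both represent the germ of `b`, so they eventually agree.
  obtain ⟨K₂, hK₂⟩ := toTails_eq_iff.1 (((strMap_atInf S.f hw).symm.trans (by rw [hab])).trans h₃)
  classical
  let x : ∀ k, S.X₁.right k := fun k => if max K₁ K₂ ≤ k then w k else z k
  have hx : IsGenDatum n a x := by
    refine ⟨ha, fun k => ?_, hw.trans (toTails_eq_iff.2 ⟨max K₁ K₂, fun k hk => ?_⟩)⟩
    · by_cases hk : max K₁ K₂ ≤ k
      · simp only [x, if_pos hk]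
        exact hK₁ k (le_trans (le_max_left _ _) hk)
      · simp only [x, if_neg hk]
        exact hz k
    · simp only [x, if_pos hk]
  obtain ⟨ψ, hψ, hψ'⟩ := exists_gen_hom hx
  refine ⟨ψ, gen_hom_ext ?_ fun k hk => ?_⟩
  · rw [atInf_comp, hψ, hab]
  · rw [atFin_comp, hψ' k hk]
    by_cases hk : max K₁ K₂ ≤ k
    · simp only [x, if_pos hk]
      exact hK₂ k (le_trans (le_max_right _ _) hk)
    · simp only [x, if_neg hk]
      exact hzy k

/-- An element of `M_∞` killed by `f` comes from a map `A(n) → M` killed by `f`. -/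
lemma exists_gen_hom_inf {M N : AlgModel p} (f : M ⟶ N) (a : M.left.obj) (ha : atInf f a = 0) :
    ∃ (n : ℕ) (φ : gen p n ⟶ M), φ ≫ f = 0 ∧ atInf φ (genOneInf p n) = a := by
  obtain ⟨n, hn⟩ := exists_topGen_fixed M.left a
  obtain ⟨x, hx⟩ := exists_strMap_eq M a
  obtain ⟨K₁, hK₁⟩ := exists_fixed_tail hx hn
  obtain ⟨K₂, hK₂⟩ := toTails_eq_zero_iff.1 ((strMap_atInf f hx).symm.trans (by rw [ha, map_zero]))
  classical
  -- Deleting the initial entries makes the sequence invariant and killed by `f` at every index,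
  -- with the same germ.
  let y : ∀ k, M.right k := fun k => if max K₁ K₂ ≤ k then x k else 0
  have hy : IsGenDatum n a y := by
    refine ⟨hn, fun k => ?_, hx.trans (toTails_eq_iff.2 ⟨max K₁ K₂, fun k hk => ?_⟩)⟩
    · by_cases hk : max K₁ K₂ ≤ k
      · simp only [y, if_pos hk]
        exact hK₁ k (le_trans (le_max_left _ _) hk)
      · simp only [y, if_neg hk, map_zero]
    · simp only [y, if_pos hk]
  obtain ⟨φ, hφ, hφ'⟩ := exists_gen_hom hy
  refine ⟨n, φ, gen_hom_ext ?_ fun k hk => ?_, hφ⟩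
  · rw [atInf_comp, hφ, ha]; rfl
  · rw [atFin_comp, hφ' k hk, atFin_zero]
    by_cases hk : max K₁ K₂ ≤ k
    · simp only [y, if_pos hk]
      exact hK₂ k (le_trans (le_max_right _ _) hk)
    · simp only [y, if_neg hk, map_zero]

/-- An element of `M_k` killed by `f` comes from a map `A(k) → M` killed by `f`. -/
lemma exists_gen_hom_fin {M N : AlgModel p} (f : M ⟶ N) (k : ℕ) (x : M.right k)
    (hx : atFin f k x = 0) :
    ∃ φ : gen p k ⟶ M, φ ≫ f = 0 ∧ atFin φ k (genOneFin p k k) = x := by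
  classical
  -- A sequence supported at one index has zero germ, so it is compatible with 0 at ∞; its
  -- invariance is automatic because p^k acts trivially on M_k.
  have hy : IsGenDatum k (0 : M.left.obj) (Pi.single k x : ∀ k, M.right k) := by
    refine ⟨map_zero _, fun l => ?_, ?_⟩
    · obtain rfl | h := eq_or_ne l k
      · rw [red_topGen_eq_one le_rfl, map_one]
        rfl
      · rw [Pi.single_eq_of_ne h, map_zero]
    · rw [map_zero]
      exact (toTails_eq_zero_iff.2
        ⟨k + 1, fun l hl => Pi.single_eq_of_ne (Nat.ne_of_gt hl) _⟩).symm
  obtain ⟨φ, hφ, hφ'⟩ := exists_gen_hom hy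
  refine ⟨φ, gen_hom_ext ?_ fun l hl => ?_, by rw [hφ' k le_rfl, Pi.single_eq_same]⟩
  · rw [atInf_comp, hφ, map_zero]; rfl
  · rw [atFin_comp, hφ' l hl, atFin_zero]
    obtain rfl | h := eq_or_ne l k
    · rw [Pi.single_eq_same, hx]
    · rw [Pi.single_eq_of_ne h, map_zero]

/-- The A(n) detect exactness: any element killed by `S.g` is the image of a generator under a map
that is itself killed by `S.g`. -/
lemma pointwiseExact_of_exists_lift {S : ShortComplex (AlgModel p)}
    (hS : ∀ (n : ℕ) (φ : gen p n ⟶ S.X₂), φ ≫ S.g = 0 → ∃ ψ : gen p n ⟶ S.X₁, ψ ≫ S.f = φ) :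
    PointwiseExact S where
  inf b hb := by
    obtain ⟨n, φ, hφ, rfl⟩ := exists_gen_hom_inf S.g b hb
    obtain ⟨ψ, rfl⟩ := hS n φ hφ
    exact ⟨_, rfl⟩
  fin k y hy := by
    obtain ⟨φ, hφ, rfl⟩ := exists_gen_hom_fin S.g k y hy
    obtain ⟨ψ, rfl⟩ := hS k φ hφ
    exact ⟨_, rfl⟩

/-- Evaluation at `k` (for `some k`) and at `∞` (for `none`). -/
def ev (p : ℕ) [Fact p.Prime] : Option ℕ → AlgModel p ⥤ ModuleCat.{0} ℚ
  | none => evInf p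
  | some k => evFin p k

instance (k : Option ℕ) : (ev p k).Additive := by
  cases k
  · exact inferInstanceAs (evInf p).Additive
  · exact inferInstanceAs (evFin p _).Additive

lemma pointwiseExact_iff (S : ShortComplex (AlgModel p)) :
    PointwiseExact S ↔ ∀ k, (S.map (ev p k)).Exact := by
  simp only [ShortComplex.moduleCat_exact_iff]
  refine ⟨fun h k => ?_, fun h => ⟨h none, fun k => h (some k)⟩⟩
  cases k
  · exact h.inf
  · exact h.fin _

/-- The pivot of the proof: pointwise statements become statements about maps out of the A(n), hence
about lifting properties, and conversely. -/
lemma exact_map_ev_iff (S : ShortComplex (AlgModel p)) :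
    (∀ k, (S.map (ev p k)).Exact) ↔
      ∀ (n : ℕ) (φ : gen p n ⟶ S.X₂), φ ≫ S.g = 0 → ∃ ψ : gen p n ⟶ S.X₁, ψ ≫ S.f = φ :=
  ⟨fun h _ φ hφ => ((pointwiseExact_iff S).2 h).exists_lift φ hφ,
    fun h => (pointwiseExact_iff S).1 (pointwiseExact_of_exists_lift h)⟩

end Exactness

/-! ### Limits and colimits in `𝓐(ℤ_p)` -/

/-! ### Limits in comma categories whose left functor has a right adjoint. -/

section CommaLimits

universe v₁ v₂ v₃ u₁ u₂ u₃ w w'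

variable {A : Type u₁} [Category.{v₁} A] {B : Type u₂} [Category.{v₂} B]
  {T : Type u₃} [Category.{v₃} T] {L : A ⥤ T} {R : B ⥤ T} {G : T ⥤ A} (adj : L ⊣ G)
  {J : Type w} [Category.{w'} J] (F : J ⥤ Comma L R)

/-- The adjoint transpose of the structure map of an object of a comma category. -/
def commaTranspose (X : Comma L R) : X.left ⟶ G.obj (R.obj X.right) :=
  adj.homEquiv _ _ X.hom

/-- Transposing along L ⊣ G moves the compatibility squares into A, where the limit is constructed.
-/
lemma commaTranspose_comm {X Y : Comma L R} (f : X.left ⟶ Y.left) (g : X.right ⟶ Y.right) :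
    L.map f ≫ Y.hom = X.hom ≫ R.map g ↔
      f ≫ commaTranspose adj Y = commaTranspose adj X ≫ G.map (R.map g) := by
  rw [commaTranspose, commaTranspose, ← adj.homEquiv_naturality_left,
    ← adj.homEquiv_naturality_right, EmbeddingLike.apply_eq_iff_eq]

/-- The transposed structure maps as a natural transformation. -/
def commaTransposeNat : Comma.fst L R ⟶ Comma.snd L R ⋙ R ⋙ G where
  app := commaTranspose adj
  naturality _ _ f := (commaTranspose_comm adj f.left f.right).1 f.w

variable [HasLimit (F ⋙ Comma.fst L R)] [HasLimit (F ⋙ Comma.snd L R)]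
  [HasLimit ((F ⋙ Comma.snd L R) ⋙ R ⋙ G)] [HasPullbacks A]

/-- The left component of a limit in a comma category `Comma L R` where `L` has a right
adjoint. -/
abbrev commaLimitLeft : A :=
  pullback (limMap (Functor.whiskerLeft F (commaTransposeNat adj)) :
    limit (F ⋙ Comma.fst L R) ⟶ limit ((F ⋙ Comma.snd L R) ⋙ R ⋙ G))
    (limit.post (F ⋙ Comma.snd L R) (R ⋙ G))

/-- A limit cone in a comma category `Comma L R` where `L` has a right adjoint. -/
def commaLimitCone : Cone F where
  pt :=
    { left := commaLimitLeft adj F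
      right := limit (F ⋙ Comma.snd L R)
      hom := (adj.homEquiv _ _).symm (pullback.snd _ _) }
  π :=
    { app j :=
        { left := pullback.fst _ _ ≫ limit.π (F ⋙ Comma.fst L R) j
          right := limit.π (F ⋙ Comma.snd L R) j
          w := by
            rw [commaTranspose_comm adj]
            have h := pullback.condition (f := (limMap (Functor.whiskerLeft F
                (commaTransposeNat adj)) : limit (F ⋙ Comma.fst L R) ⟶
                  limit ((F ⋙ Comma.snd L R) ⋙ R ⋙ G)))
              (g := limit.post (F ⋙ Comma.snd L R) (R ⋙ G)) =≫
                limit.π ((F ⋙ Comma.snd L R) ⋙ R ⋙ G) j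
            rw [Category.assoc, Category.assoc, limMap_π, limit.post_π] at h
            rw [Category.assoc]
            exact h.trans (congrArg (· ≫ _)
              ((adj.homEquiv _ _).apply_symm_apply (pullback.snd _ _)).symm) }
      naturality j j' f := by
        ext
        · simpa using congrArg (fun t => pullback.fst _ _ ≫ t)
            (limit.w (F ⋙ Comma.fst L R) f).symm
        · simpa using (limit.w (F ⋙ Comma.snd L R) f).symm }

/-- The cone `commaLimitCone` is a limit. -/
def commaLimitConeIsLimit : IsLimit (commaLimitCone adj F) where
  lift s :=
    { left := pullback.lift (limit.lift _ ((Comma.fst L R).mapCone s))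
        (commaTranspose adj s.pt ≫ G.map (R.map (limit.lift _ ((Comma.snd L R).mapCone s)))) (by
          refine limit.hom_ext fun j => ?_
          rw [Category.assoc, Category.assoc, Category.assoc, limMap_π, limit.lift_π_assoc,
            limit.post_π]
          refine ((commaTranspose_comm adj _ _).1 (s.π.app j).w).trans ?_
          congr 1
          rw [Functor.comp_map, ← G.map_comp, ← R.map_comp, limit.lift_π]
          rfl)
      right := limit.lift _ ((Comma.snd L R).mapCone s)
      w := (commaTranspose_comm adj (Y := (commaLimitCone adj F).pt) _ _).2
        ((congrArg (_ ≫ ·) ((adj.homEquiv _ _).apply_symm_apply (pullback.snd _ _))).trans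
          (pullback.lift_snd _ _ _)) }
  fac s j := by
    ext
    · exact (pullback.lift_fst_assoc _ _ _ _).trans (limit.lift_π _ _)
    · exact limit.lift_π _ _
  uniq s m hm := by
    have hr : m.right = limit.lift _ ((Comma.snd L R).mapCone s) := by
      refine limit.hom_ext fun j => ?_
      rw [limit.lift_π]
      exact congrArg CommaMorphism.right (hm j)
    refine CommaMorphism.ext (pullback.hom_ext ?_ ?_) hr
    · refine (limit.hom_ext fun j => ?_).trans (pullback.lift_fst _ _ _).symm
      refine Eq.trans ?_ (limit.lift_π ((Comma.fst L R).mapCone s) j).symm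
      exact (Category.assoc _ _ _).trans (congrArg CommaMorphism.left (hm j))
    · refine Eq.trans ?_ (pullback.lift_snd _ _ _).symm
      rw [← hr]
      exact (congrArg (m.left ≫ ·)
        ((adj.homEquiv _ _).apply_symm_apply (pullback.snd _ _))).symm.trans
          ((commaTranspose_comm adj _ _).1 m.w)

/-- Neither functor has to preserve limits: the pullback along `limit.post` corrects the left
component for the failure of R ⋙ G to do so. -/
lemma hasLimitsOfShape_comma_of_adjunction {A : Type u₁} [Category.{v₁} A] {B : Type u₂}
    [Category.{v₂} B] {T : Type u₃} [Category.{v₃} T] {L : A ⥤ T} {R : B ⥤ T} {G : T ⥤ A}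
    (adj : L ⊣ G) (J : Type w) [Category.{w'} J] [HasLimitsOfShape J A] [HasLimitsOfShape J B]
    [HasPullbacks A] : HasLimitsOfShape J (Comma L R) where
  has_limit F := ⟨⟨_, commaLimitConeIsLimit adj F⟩⟩

end CommaLimits

/-! ### Coreflectivity of discrete modules; limits and colimits in 𝓐(ℤ_p) and dg 𝓐(ℤ_p). -/

section Discrete

variable (p : ℕ) [Fact p.Prime]

/-- The discrete part of a rational `ℤ_p`-module. -/
def discreteSubmodule (M : Rep.{0} ℚ (Multiplicative ℤ_[p])) : Submodule ℚ M where
  carrier := {m | ∃ n : ℕ, ∀ g : Multiplicative ℤ_[p], red p n g = 1 → M.ρ g m = m}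
  zero_mem' := ⟨0, fun _ _ => map_zero _⟩
  add_mem' := by
    rintro x y ⟨n, hn⟩ ⟨m, hm⟩
    refine ⟨max n m, fun g hg => ?_⟩
    rw [map_add, hn g, hm g]
    · rw [← proj_red p (le_max_right n m), hg, map_one]
    · rw [← proj_red p (le_max_left n m), hg, map_one]
  smul_mem' := by
    rintro c x ⟨n, hn⟩
    exact ⟨n, fun g hg => by rw [map_smul, hn g hg]⟩

lemma discreteSubmodule_le (M : Rep.{0} ℚ (Multiplicative ℤ_[p])) (g : Multiplicative ℤ_[p]) :
    discreteSubmodule p M ≤ (discreteSubmodule p M).comap (M.ρ g) := by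
  rintro x ⟨n, hn⟩
  refine ⟨n, fun h hh => ?_⟩
  rw [← Module.End.mul_apply, ← map_mul, mul_comm, map_mul, Module.End.mul_apply, hn h hh]

/-- The discrete part of a rational `ℤ_p`-module as a discrete module. -/
def discretePart (M : Rep.{0} ℚ (Multiplicative ℤ_[p])) : DiscRep p where
  obj := Rep.of (M.ρ.subrepresentation (discreteSubmodule p M) (discreteSubmodule_le p M))
  property := by
    rintro ⟨m, n, hn⟩
    exact ⟨n, fun g hg => Subtype.ext (hn g hg)⟩

/-- Maps from a discrete module land in the discrete part. -/
def discretePartHomEquiv (M : DiscRep p) (N : Rep.{0} ℚ (Multiplicative ℤ_[p])) :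
    ((isDiscrete p).ι.obj M ⟶ N) ≃ (M ⟶ discretePart p N) where
  toFun f := ObjectProperty.homMk (Rep.ofHom
    { toLinearMap := f.hom.toLinearMap.codRestrict (discreteSubmodule p N) fun m => by
        obtain ⟨n, hn⟩ := M.property m
        refine ⟨n, fun g hg => ?_⟩
        refine (Rep.hom_comm_apply f g m).symm.trans ?_
        exact congrArg f.hom (hn g hg)
      isIntertwining' := fun g => LinearMap.ext fun m => Subtype.ext (Rep.hom_comm_apply f g m) })
  invFun f := f.hom ≫ Rep.ofHom
    { toLinearMap := (discreteSubmodule p N).subtype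
      isIntertwining' := fun _ => rfl }
  left_inv f := rfl
  right_inv f := rfl

/-- This gives limits and colimits of discrete modules. As a left adjoint the inclusion preserves
colimits, which yields colimits in the comma category; its right adjoint yields the limits. -/
instance : Coreflective (isDiscrete p).ι where
  R := _
  adj := Adjunction.adjunctionOfEquivRight (discretePartHomEquiv p) (fun _ _ _ _ _ => rfl)

instance : HasColimits (DiscRep p) := hasColimits_of_coreflective (isDiscrete p).ι

instance : HasLimits (DiscRep p) := hasLimits_of_coreflective (isDiscrete p).ι

instance (J : Type) [SmallCategory J] : HasColimitsOfShape J (FinPart p) :=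
  ⟨fun _ => CategoryTheory.pi.hasColimit_of_hasColimit_comp_eval⟩

instance (J : Type) [SmallCategory J] : HasLimitsOfShape J (FinPart p) :=
  ⟨fun _ => CategoryTheory.pi.hasLimit_of_hasLimit_comp_eval⟩

instance (J : Type) [SmallCategory J] (k : ℕ) : PreservesColimitsOfShape J
    (Pi.eval (fun k : ℕ => Rep.{0} ℚ (Multiplicative (ZMod (p ^ k)))) k) where
  preservesColimit {F} := preservesColimit_of_preserves_colimit_cocone
    (CategoryTheory.pi.coconeOfCoconeEvalIsColimit
      fun k => colimit.isColimit (F ⋙ Pi.eval _ k)) (colimit.isColimit (F ⋙ Pi.eval _ k))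

instance : HasColimits (AlgModel p) where
  has_colimits_of_shape _ _ := inferInstance

instance : HasLimits (AlgModel p) where
  has_limits_of_shape J _ :=
    hasLimitsOfShape_comma_of_adjunction (coreflectorAdjunction (isDiscrete p).ι) J

variable {p}

/-- Colimits are pointwise. Limits are not treated this way: their value at ∞ involves a discrete
part and a pullback. -/
instance (k : Option ℕ) : PreservesColimits (ev p k) where
  preservesColimitsOfShape {J _} := by
    cases k
    · exact inferInstanceAs (PreservesColimitsOfShape J (evInf p))
    · exact inferInstanceAs (PreservesColimitsOfShape J (evFin p _))

instance : HasLimits (DGAlgModel p) where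
instance : HasColimits (DGAlgModel p) where

end Discrete

/-! ### Finite presentability -/

section Presentable

/-- A criterion for finite presentability in preadditive categories. -/
lemma isFinitelyPresentable_of_exists {C : Type*} [Category.{0} C] [Preadditive C] (X : C)
    (h₁ : ∀ {J : Type} [SmallCategory J] [IsFiltered J] {F : J ⥤ C} {c : Cocone F}
      (_ : IsColimit c) (f : X ⟶ c.pt), ∃ (j : J) (g : X ⟶ F.obj j), g ≫ c.ι.app j = f)
    (h₂ : ∀ {J : Type} [SmallCategory J] [IsFiltered J] {F : J ⥤ C} {c : Cocone F}
      (_ : IsColimit c) (j : J) (f : X ⟶ F.obj j), f ≫ c.ι.app j = 0 →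
        ∃ (j' : J) (u : j ⟶ j'), f ≫ F.map u = 0) :
    IsFinitelyPresentable.{0} X := by
  rw [isFinitelyPresentable_iff_preservesFilteredColimits]
  refine ⟨fun J _ _ => ⟨fun {F} => ⟨fun {c} hc => ⟨?_⟩⟩⟩⟩
  refine Types.FilteredColimit.isColimitOf _ _ (fun f => ?_) (fun i j f g hfg => ?_)
  · obtain ⟨j, g, hg⟩ := h₁ hc f
    exact ⟨j, g, hg.symm⟩
  · replace hfg : f ≫ c.ι.app i = g ≫ c.ι.app j := hfg
    obtain ⟨k, u, hu⟩ := h₂ hc (IsFiltered.max i j)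
      (f ≫ F.map (IsFiltered.leftToMax i j) - g ≫ F.map (IsFiltered.rightToMax i j)) (by
        rw [Preadditive.sub_comp, Category.assoc, Category.assoc, c.w, c.w, hfg, sub_self])
    refine ⟨k, IsFiltered.leftToMax i j ≫ u, IsFiltered.rightToMax i j ≫ u, ?_⟩
    rw [Preadditive.sub_comp, sub_eq_zero, Category.assoc, Category.assoc, ← F.map_comp,
      ← F.map_comp] at hu
    exact hu

variable {p : ℕ} [Fact p.Prime] {J : Type} [SmallCategory J] [IsFiltered J]
  {F : J ⥤ AlgModel p} {c : Cocone F} (hc : IsColimit c)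

include hc

lemma exists_atInf_eq (a : c.pt.left.obj) : ∃ (j : J) (b : (F.obj j).left.obj),
    atInf (c.ι.app j) b = a :=
  Concrete.isColimit_exists_rep (F ⋙ ev p none) (isColimitOfPreserves (ev p none) hc)
    (show ToType ((ev p none).mapCocone c).pt from a)

lemma exists_atFin_eq (k : ℕ) (x : c.pt.right k) : ∃ (j : J) (y : (F.obj j).right k),
    atFin (c.ι.app j) k y = x :=
  Concrete.isColimit_exists_rep (F ⋙ ev p (some k)) (isColimitOfPreserves (ev p (some k)) hc)
    (show ToType ((ev p (some k)).mapCocone c).pt from x)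

lemma exists_atInf_map_eq {j : J} {a b : (F.obj j).left.obj}
    (h : atInf (c.ι.app j) a = atInf (c.ι.app j) b) :
    ∃ (j' : J) (u : j ⟶ j'), atInf (F.map u) a = atInf (F.map u) b := by
  obtain ⟨j', u, v, h⟩ := Concrete.isColimit_exists_of_rep_eq (F ⋙ ev p none)
    (isColimitOfPreserves (ev p none) hc) a b h
  -- The two transition maps `u` and `v` may differ; coequalizing them leaves one.
  refine ⟨_, u ≫ IsFiltered.coeqHom u v, ?_⟩
  replace h : atInf (F.map u) a = atInf (F.map v) b := h
  rw [F.map_comp, atInf_comp, h, ← atInf_comp, ← F.map_comp, ← IsFiltered.coeq_condition, F.map_comp]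

lemma exists_atFin_map_eq {k : ℕ} {j : J} {x y : (F.obj j).right k}
    (h : atFin (c.ι.app j) k x = atFin (c.ι.app j) k y) :
    ∃ (j' : J) (u : j ⟶ j'), atFin (F.map u) k x = atFin (F.map u) k y := by
  obtain ⟨j', u, v, h⟩ := Concrete.isColimit_exists_of_rep_eq (F ⋙ ev p (some k))
    (isColimitOfPreserves (ev p (some k)) hc) x y h
  refine ⟨_, u ≫ IsFiltered.coeqHom u v, ?_⟩
  replace h : atFin (F.map u) k x = atFin (F.map v) k y := h
  rw [F.map_comp, atFin_comp, h, ← atFin_comp, ← F.map_comp, ← IsFiltered.coeq_condition, F.map_comp]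

omit [IsFiltered J] hc in
lemma atInf_ι_map {j j' : J} (u : j ⟶ j') (a : (F.obj j).left.obj) :
    atInf (c.ι.app j') (atInf (F.map u) a) = atInf (c.ι.app j) a := by
  rw [← atInf_comp, c.w]

omit [IsFiltered J] hc in
lemma atFin_ι_map {j j' : J} (u : j ⟶ j') (k : ℕ) (x : (F.obj j).right k) :
    atFin (c.ι.app j') k (atFin (F.map u) k x) = atFin (c.ι.app j) k x := by
  rw [← atFin_comp, c.w]

/-- Being fixed by the single element g is one equation, so it already holds at a later stage of the
filtered diagram. -/
lemma exists_inf_fixed (g : Multiplicative ℤ_[p]) (a : c.pt.left.obj)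
    (ha : c.pt.left.obj.ρ g a = a) :
    ∃ (j : J) (b : (F.obj j).left.obj), (F.obj j).left.obj.ρ g b = b ∧
      atInf (c.ι.app j) b = a := by
  obtain ⟨j, b, rfl⟩ := exists_atInf_eq hc a
  obtain ⟨j', u, hu⟩ := exists_atInf_map_eq hc (a := (F.obj j).left.obj.ρ g b) (b := b)
    ((atInf_ρ _ _ _).trans ha)
  exact ⟨j', atInf (F.map u) b, by rw [← atInf_ρ, hu], atInf_ι_map u b⟩

lemma exists_fin_fixed (j : J) (k : ℕ) (g : Multiplicative (ZMod (p ^ k))) (x : c.pt.right k)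
    (hx : (c.pt.right k).ρ g x = x) :
    ∃ (j' : J) (_ : j ⟶ j') (y : (F.obj j').right k), ((F.obj j').right k).ρ g y = y ∧
      atFin (c.ι.app j') k y = x := by
  obtain ⟨i, y, rfl⟩ := exists_atFin_eq hc k x
  obtain ⟨i', u, hu⟩ := exists_atFin_map_eq hc (x := ((F.obj i).right k).ρ g y) (y := y)
    ((atFin_ρ _ _ _ _).trans hx)
  refine ⟨IsFiltered.max j i', IsFiltered.leftToMax _ _,
    atFin (F.map (u ≫ IsFiltered.rightToMax _ _)) k y, ?_, atFin_ι_map _ k y⟩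
  rw [F.map_comp, atFin_comp, ← atFin_ρ, ← atFin_ρ, hu]

/-- Moving along a filtered diagram can settle only finitely many k at once, hence the bound K and
the induction. -/
lemma exists_fin_fixed_of_lt (j : J) (g : Multiplicative ℤ_[p]) (x : ∀ k, c.pt.right k)
    (hx : ∀ k, (c.pt.right k).ρ (red p k g) (x k) = x k) (K : ℕ) :
    ∃ (j' : J) (_ : j ⟶ j'), ∀ k < K, ∃ y : (F.obj j').right k,
      ((F.obj j').right k).ρ (red p k g) y = y ∧ atFin (c.ι.app j') k y = x k := by
  induction K with
  | zero => exact ⟨j, 𝟙 j, fun k hk => (Nat.not_lt_zero k hk).elim⟩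
  | succ K ih =>
    obtain ⟨j', u, h⟩ := ih
    obtain ⟨i, v, z, hz, hz'⟩ := exists_fin_fixed hc j' K _ _ (hx K)
    refine ⟨i, u ≫ v, fun k hk => ?_⟩
    obtain hk | rfl := Nat.lt_succ_iff_lt_or_eq.1 hk
    · obtain ⟨y, hy, hy'⟩ := h k hk
      exact ⟨atFin (F.map v) k y, by rw [← atFin_ρ, hy], (atFin_ι_map v k y).trans hy'⟩
    · exact ⟨z, hz, hz'⟩

lemma exists_fin_eq_zero_of_lt (j : J) (x : ∀ k, (F.obj j).right k)
    (hx : ∀ k, atFin (c.ι.app j) k (x k) = 0) (K : ℕ) :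
    ∃ (j' : J) (u : j ⟶ j'), ∀ k < K, atFin (F.map u) k (x k) = 0 := by
  induction K with
  | zero => exact ⟨j, 𝟙 j, fun k hk => (Nat.not_lt_zero k hk).elim⟩
  | succ K ih =>
    obtain ⟨j', u, h⟩ := ih
    obtain ⟨i, v, hv⟩ := exists_atFin_map_eq hc (j := j') (x := atFin (F.map u) K (x K)) (y := 0)
      (by rw [atFin_ι_map, hx, map_zero])
    refine ⟨i, u ≫ v, fun k hk => ?_⟩
    rw [F.map_comp, atFin_comp]
    obtain hk | rfl := Nat.lt_succ_iff_lt_or_eq.1 hk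
    · rw [h k hk, map_zero]
    · rw [hv, map_zero]

-- A map from A(n) has infinitely many components, but once the value at ∞ is lifted to a stage, a
-- representative of its germ supplies all but finitely many of them. Filteredness takes care of the
-- rest, for existence as well as for vanishing.
omit hc in
instance (n : ℕ) : IsFinitelyPresentable.{0} (gen p n) := by
  refine isFinitelyPresentable_of_exists _ (fun {J _ _ F c} hc φ => ?_)
    (fun {J _ _ F c} hc j φ hφ => ?_)
  · obtain ⟨h₁, h₂, h₃⟩ := isGenDatum_of_hom φ
    obtain ⟨j₀, a, ha, haφ⟩ := exists_inf_fixed hc _ _ h₁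
    obtain ⟨w, hw⟩ := exists_strMap_eq _ a
    obtain ⟨K₁, hK₁⟩ := exists_fixed_tail hw ha
    obtain ⟨K₂, hK₂⟩ := toTails_eq_iff.1
      (((strMap_atInf (c.ι.app j₀) hw).symm.trans (by rw [haφ]; rfl)).trans h₃)
    obtain ⟨j, u, hu⟩ := exists_fin_fixed_of_lt hc j₀ _ _ h₂ (max K₁ K₂)
    have hx : ∀ k, ∃ y, ((F.obj j).right k).ρ (red p k (topGen p n)) y = y ∧
        atFin (c.ι.app j) k y = atFin φ k (genOneFin p n k) ∧
        (max K₁ K₂ ≤ k → y = atFin (F.map u) k (w k)) := by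
      intro k
      by_cases hk : max K₁ K₂ ≤ k
      · refine ⟨atFin (F.map u) k (w k), ?_, ?_, fun _ => rfl⟩
        · rw [← atFin_ρ, hK₁ k (le_trans (le_max_left _ _) hk)]
        · rw [atFin_ι_map]
          exact hK₂ k (le_trans (le_max_right _ _) hk)
      · obtain ⟨y, hy, hy'⟩ := hu k (not_le.1 hk)
        exact ⟨y, hy, hy', fun h => (hk h).elim⟩
    choose x hx hxφ hxw using hx
    have hdat : IsGenDatum n (atInf (F.map u) a) x :=
      ⟨by rw [← atInf_ρ, ha], hx, (strMap_atInf (F.map u) hw).trans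
        (toTails_eq_iff.2 ⟨max K₁ K₂, fun k hk => (hxw k hk).symm⟩)⟩
    obtain ⟨ψ, hψ, hψ'⟩ := exists_gen_hom hdat
    refine ⟨j, ψ, gen_hom_ext ?_ fun k hk => ?_⟩
    · rw [atInf_comp, hψ, atInf_ι_map, haφ]
    · rw [atFin_comp, hψ' k hk, hxφ]
  · obtain ⟨j₁, u, hu⟩ := exists_atInf_map_eq hc (j := j) (a := atInf φ (genOneInf p n)) (b := 0)
      (by rw [← atInf_comp, hφ, map_zero]; rfl)
    -- Once the value at ∞ is zero, the sequence has zero germ and vanishes from some K on; the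
    -- entries below K are killed at a later stage.
    have h₃ := (isGenDatum_of_hom (φ ≫ F.map u)).str
    rw [atInf_comp, hu, map_zero, map_zero] at h₃
    obtain ⟨K, hK⟩ := toTails_eq_zero_iff.1 h₃.symm
    obtain ⟨j₂, v, hv⟩ := exists_fin_eq_zero_of_lt hc j₁
      (fun k => atFin (φ ≫ F.map u) k (genOneFin p n k))
      (fun k => by rw [← atFin_comp, Category.assoc, c.w, hφ]; rfl) K
    refine ⟨j₂, u ≫ v, gen_hom_ext ?_ fun k _ => ?_⟩
    · rw [F.map_comp, ← Category.assoc, atInf_comp, atInf_comp, hu, map_zero, map_zero]; rfl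
    · rw [F.map_comp, ← Category.assoc, atFin_comp, atFin_zero]
      by_cases hk : K ≤ k
      · rw [hK k hk, map_zero]
      · exact hv k (not_le.1 hk)

end Presentable

/-! ### Quasi-isomorphisms of complexes of modules in terms of elements -/

section ModuleComplexes

variable {K L : ChainComplex (ModuleCat.{0} ℚ) ℤ} (f : K ⟶ L)

/-- Maps that lift, up to a surjection, a map `A → N` along `g : M → N`, in terms of elements. -/
lemma exists_refinement_of_forall_exists {A M : ModuleCat.{0} ℚ} (P : A → M → Prop)
    (h : ∀ a, ∃ m, P a m) : ∃ (A' : ModuleCat.{0} ℚ) (π : A' ⟶ A) (_ : Epi π) (x : A' ⟶ M),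
      ∃ (b : A → A') , Submodule.span ℚ (Set.range b) = ⊤ ∧ ∀ a, π (b a) = a ∧ P a (x (b a)) := by
  choose s hs using h
  -- A choice function for P need not be linear on A, but it extends linearly to the free module on
  -- the underlying set.
  refine ⟨ModuleCat.of ℚ (A →₀ ℚ), ModuleCat.ofHom (Finsupp.linearCombination ℚ id), ?_,
    ModuleCat.ofHom (Finsupp.linearCombination ℚ s), fun a => Finsupp.single a 1, ?_,
    fun a => ⟨?_, ?_⟩⟩
  · rw [ModuleCat.epi_iff_surjective]
    exact fun a => ⟨Finsupp.single a 1, by simp⟩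
  · exact Finsupp.basisSingleOne.span_eq
  · simp
  · simpa using hs a

lemma moduleCat_hom_ext_of_span {A B : ModuleCat.{0} ℚ} {ι : Type} {b : ι → A}
    (hb : Submodule.span ℚ (Set.range b) = ⊤) {u v : A ⟶ B} (h : ∀ i, u (b i) = v (b i)) :
    u = v := by
  ext1
  refine LinearMap.ext_on_range hb h

/-- Elements are maps from ℚ, which gives one direction of the comparison with the criterion up to
refinements; free modules provide the refinement in the other. -/
lemma mono_homologyMap_iff (m : ℤ) : Mono (HomologicalComplex.homologyMap f m) ↔
    ∀ (x : K.X m), (∀ j, K.d m j x = 0) → ∀ y : L.X (m + 1), f.f m x = L.d (m + 1) m y →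
      ∃ z : K.X (m + 1), K.d (m + 1) m z = x := by
  rw [HomologicalComplex.mono_homologyMap_iff_up_to_refinements f (m + 1) m (m - 1)
    (by simp) (by simp)]
  constructor
  · intro h x hx y hxy
    obtain ⟨A', π, _, x₁, hx₁⟩ := h (A := ModuleCat.of ℚ ℚ)
      (ModuleCat.ofHom (LinearMap.toSpanSingleton ℚ _ x))
      (ModuleCat.hom_ext (LinearMap.ext_ring (by simpa using hx (m - 1))))
      (ModuleCat.ofHom (LinearMap.toSpanSingleton ℚ _ y))
      (ModuleCat.hom_ext (LinearMap.ext_ring (by simpa using hxy)))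
    obtain ⟨a, ha⟩ := (ModuleCat.epi_iff_surjective π).1 inferInstance (1 : ℚ)
    refine ⟨x₁ a, ?_⟩
    have := ConcreteCategory.congr_hom hx₁ a
    simp only [ModuleCat.hom_comp, LinearMap.comp_apply, ha] at this
    simpa using this.symm
  · intro h A x₂ hx₂ y₁ hy₁
    obtain ⟨A', π, hπ, x, b, hb, hx⟩ := exists_refinement_of_forall_exists
      (fun (a : A) (z : K.X (m + 1)) => K.d (m + 1) m z = x₂ a) (fun a => by
        refine h (x₂ a) (fun j => ?_) (y₁ a) (ConcreteCategory.congr_hom hy₁ a)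
        by_cases hj : j = m - 1
        · subst hj
          exact ConcreteCategory.congr_hom hx₂ a
        · rw [K.shape _ _ (by simp; omega)]
          rfl)
    refine ⟨A', π, hπ, x, moduleCat_hom_ext_of_span hb fun a => ?_⟩
    simp [(hx a).1, (hx a).2]

lemma epi_homologyMap_iff (m : ℤ) : Epi (HomologicalComplex.homologyMap f m) ↔
    ∀ (y : L.X m), (∀ j, L.d m j y = 0) → ∃ x : K.X m, (∀ j, K.d m j x = 0) ∧
      ∃ y' : L.X (m + 1), y = f.f m x + L.d (m + 1) m y' := by
  rw [HomologicalComplex.epi_homologyMap_iff_up_to_refinements f (m + 1) m (m - 1)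
    (by simp) (by simp)]
  constructor
  · intro h y hy
    obtain ⟨A', π, _, x₂, hx₂, y₁, hy₁⟩ := h (A := ModuleCat.of ℚ ℚ)
      (ModuleCat.ofHom (LinearMap.toSpanSingleton ℚ _ y))
      (ModuleCat.hom_ext (LinearMap.ext_ring (by simpa using hy (m - 1))))
    obtain ⟨a, ha⟩ := (ModuleCat.epi_iff_surjective π).1 inferInstance (1 : ℚ)
    refine ⟨x₂ a, fun j => ?_, y₁ a, ?_⟩
    · by_cases hj : j = m - 1
      · subst hj
        exact ConcreteCategory.congr_hom hx₂ a
      · rw [K.shape _ _ (by simp; omega)]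
        rfl
    · have := ConcreteCategory.congr_hom hy₁ a
      simp only [ModuleCat.hom_comp, LinearMap.comp_apply, ha] at this
      simpa using this
  · intro h A y₂ hy₂
    obtain ⟨A', π, hπ, x, b, hb, hx⟩ := exists_refinement_of_forall_exists
      (M := ModuleCat.of ℚ (K.X m × L.X (m + 1)))
      (fun (a : A) z => K.d m (m - 1) z.1 = 0 ∧ y₂ a = f.f m z.1 + L.d (m + 1) m z.2) (fun a => by
        obtain ⟨x, hx, y', hy'⟩ := h (y₂ a) (fun j => by
          by_cases hj : j = m - 1
          · subst hj
            exact ConcreteCategory.congr_hom hy₂ a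
          · rw [L.shape _ _ (by simp; omega)]
            rfl)
        exact ⟨(x, y'), hx _, hy'⟩)
    refine ⟨A', π, hπ, x ≫ ModuleCat.ofHom (LinearMap.fst ℚ _ _),
      moduleCat_hom_ext_of_span hb fun a => (hx a).2.1, x ≫ ModuleCat.ofHom (LinearMap.snd ℚ _ _),
      moduleCat_hom_ext_of_span hb fun a => ?_⟩
    exact (congrArg y₂ (hx a).1).trans (hx a).2.2

lemma quasiIso_iff_elements : QuasiIso f ↔
    (∀ (m : ℤ) (x : K.X m), (∀ j, K.d m j x = 0) → ∀ y : L.X (m + 1),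
      f.f m x = L.d (m + 1) m y → ∃ z : K.X (m + 1), K.d (m + 1) m z = x) ∧
    (∀ (m : ℤ) (y : L.X m), (∀ j, L.d m j y = 0) → ∃ x : K.X m, (∀ j, K.d m j x = 0) ∧
      ∃ y' : L.X (m + 1), y = f.f m x + L.d (m + 1) m y') := by
  simp only [← mono_homologyMap_iff, ← epi_homologyMap_iff, ← forall_and, quasiIso_iff,
    quasiIsoAt_iff_isIso_homologyMap]
  exact forall_congr' fun m => ⟨fun _ => ⟨inferInstance, inferInstance⟩,
    fun ⟨_, _⟩ => isIso_of_mono_of_epi _⟩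

lemma d_d_apply (i j k : ℤ) (x : K.X i) : K.d j k (K.d i j x) = 0 :=
  ConcreteCategory.congr_hom (K.d_comp_d i j k) x

lemma f_d_apply (i j : ℤ) (x : K.X i) : f.f j (K.d i j x) = L.d i j (f.f i x) :=
  (ConcreteCategory.congr_hom (f.comm i j) x).symm

/-- Surjective quasi-isomorphisms, in terms of elements. -/
lemma surjective_and_quasiIso_iff_elements :
    ((∀ m, Function.Surjective (f.f m)) ∧ QuasiIso f) ↔
      ∀ (m : ℤ) (x : K.X m), (∀ j, K.d m j x = 0) → ∀ y : L.X (m + 1),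
        f.f m x = L.d (m + 1) m y → ∃ z : K.X (m + 1), K.d (m + 1) m z = x ∧ f.f (m + 1) z = y := by
  rw [quasiIso_iff_elements]
  constructor
  · rintro ⟨hs, h₁, h₂⟩ m x hx y hxy
    obtain ⟨z₀, rfl⟩ := h₁ m x hx y hxy
    -- The error `f z₀ - y` is a cycle, so it is `f w + d v` with `w` a cycle; lifting `v` along `f`
    -- gives the correction of `z₀`.
    obtain ⟨w, hw, v, hv⟩ := h₂ (m + 1) (f.f (m + 1) z₀ - y) (fun j => by
      by_cases hj : j = m
      · subst hj
        rw [map_sub, ← hxy, f_d_apply, sub_self]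
      · rw [L.shape _ _ (by simp; omega)]
        rfl)
    obtain ⟨v, rfl⟩ := hs _ v
    refine ⟨z₀ - w - K.d _ _ v, ?_, ?_⟩
    · rw [map_sub, map_sub, hw, d_d_apply, sub_zero, sub_zero]
    · rw [map_sub, map_sub, f_d_apply, sub_sub, ← hv, sub_sub_cancel]
  · intro h
    -- The case `x = 0` of the hypothesis: cycles lift to cycles.
    have hc : ∀ (m : ℤ) (y : L.X (m + 1)), L.d (m + 1) m y = 0 →
        ∃ x : K.X (m + 1), K.d (m + 1) m x = 0 ∧ f.f (m + 1) x = y := fun m y hy =>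
      h m 0 (fun j => map_zero _) y (by rw [map_zero, hy])
    have hc' : ∀ (m : ℤ) (y : L.X m), (∀ j, L.d m j y = 0) →
        ∃ x : K.X m, (∀ j, K.d m j x = 0) ∧ f.f m x = y := fun m y hy => by
      obtain ⟨m, rfl⟩ : ∃ m', m = m' + 1 := ⟨m - 1, by omega⟩
      obtain ⟨x, hx, hxy⟩ := hc m y (hy m)
      refine ⟨x, fun j => ?_, hxy⟩
      by_cases hj : j = m
      · subst hj
        exact hx
      · rw [K.shape _ _ (by simp; omega)]
        rfl
    refine ⟨fun m y => ?_, fun m x hx y hxy => ?_, fun m y hy => ?_⟩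
    · obtain ⟨m, rfl⟩ : ∃ m', m = m' + 1 := ⟨m - 1, by omega⟩
      -- To lift an arbitrary `y`, lift the cycle `d y` to a cycle `x` and solve the problem for the
      -- pair `(x, y)`.
      obtain ⟨x, hx, hxy⟩ := hc' m (L.d (m + 1) m y) (fun j => d_d_apply _ _ _ _)
      obtain ⟨z, -, hz⟩ := h m x hx y hxy
      exact ⟨z, hz⟩
    · obtain ⟨z, hz, -⟩ := h m x hx y hxy
      exact ⟨z, hz⟩
    · obtain ⟨x, hx, hxy⟩ := hc' m y hy
      exact ⟨x, hx, 0, by rw [map_zero, add_zero, hxy]⟩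

end ModuleComplexes

/-! ### Lifting properties with respect to spheres and disks -/

section Lifting

variable {A : Type*} [Category* A] [Preadditive A] [HasZeroObject A]

/-- The inclusion of the sphere on `G` in the disk on `G`. -/
def singleToDouble (G : A) (m : ℤ) : (HomologicalComplex.single A (ComplexShape.down ℤ) m).obj G ⟶
    HomologicalComplex.double (𝟙 G) (rel_succ m) :=
  HomologicalComplex.mkHomFromSingle
    (HomologicalComplex.doubleXIso₁ (𝟙 G) (rel_succ m) (by omega)).inv
    (fun k _ => by rw [HomologicalComplex.double_d_eq_zero₀ _ _ _ _ (by omega), comp_zero])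

lemma singleToDouble_f (G : A) (m : ℤ) : (singleToDouble G m).f m =
    (HomologicalComplex.singleObjXSelf _ m G).hom ≫
      (HomologicalComplex.doubleXIso₁ (𝟙 G) (rel_succ m) (by omega)).inv :=
  HomologicalComplex.mkHomFromSingle_f _ _

variable {X Y : ChainComplex A ℤ} (f : X ⟶ Y) (G : A) (m : ℤ)

omit [HasZeroObject A] in
lemma comp_d_eq_zero {x : G ⟶ X.X m} (hx : x ≫ X.d m (m - 1) = 0) (j : ℤ) : x ≫ X.d m j = 0 := by
  by_cases hj : j = m - 1
  · subst hj
    exact hx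
  · rw [X.shape _ _ (by simp; omega), comp_zero]

/-- The disk corepresents X ↦ Hom(G, X_{m+1}). -/
lemma double_id_hom_ext {φ ψ : HomologicalComplex.double (𝟙 G) (rel_succ m) ⟶ X}
    (h : φ.f (m + 1) = ψ.f (m + 1)) : φ = ψ :=
  (HomologicalComplex.evalCompCoyonedaCorepresentableByDoubleId (rel_succ m) (by omega)
    G).homEquiv.injective (congrArg
      ((HomologicalComplex.doubleXIso₀ (𝟙 G) (rel_succ m)).inv ≫ ·) h)

/-- A map from the sphere is a G-valued cycle x in degree m, a map from the disk is any G-valued y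
in degree m + 1, and commutativity of the square says that x maps to the boundary of y. -/
lemma hasLiftingProperty_singleToDouble_iff :
    HasLiftingProperty (singleToDouble G m) f ↔
      ∀ (x : G ⟶ X.X m) (y : G ⟶ Y.X (m + 1)), x ≫ X.d m (m - 1) = 0 →
        x ≫ f.f m = y ≫ Y.d (m + 1) m → ∃ z : G ⟶ X.X (m + 1), z ≫ X.d (m + 1) m = x ∧
          z ≫ f.f (m + 1) = y := by
  have hm : m + 1 ≠ m := by omega
  constructor
  · intro h x y hx hxy
    have sq : CommSq (HomologicalComplex.mkHomFromSingle x fun k _ => comp_d_eq_zero G m hx k)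
        (singleToDouble G m) f (HomologicalComplex.mkHomFromDouble (rel_succ m) hm y
          (y ≫ Y.d (m + 1) m) (by simp) (by simp)) := ⟨by
      apply HomologicalComplex.from_single_hom_ext
      simp [singleToDouble, hxy]⟩
    refine ⟨(HomologicalComplex.doubleXIso₀ (𝟙 G) (rel_succ m)).inv ≫ sq.lift.f (m + 1), ?_, ?_⟩
    · have h1 := HomologicalComplex.congr_hom sq.fac_left m
      rw [HomologicalComplex.comp_f, singleToDouble_f, Category.assoc,
        HomologicalComplex.mkHomFromSingle_f, Iso.cancel_iso_hom_left] at h1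
      rw [Category.assoc, sq.lift.comm, HomologicalComplex.double_d _ _ hm]
      simpa using h1
    · have h1 := HomologicalComplex.congr_hom sq.fac_right (m + 1)
      simp only [HomologicalComplex.comp_f, HomologicalComplex.mkHomFromDouble_f₀] at h1
      rw [Category.assoc, h1]
      simp
  · intro h
    refine ⟨fun {a b} sq => ?_⟩
    obtain ⟨z, hz, hz'⟩ := h ((HomologicalComplex.singleObjXSelf _ m G).inv ≫ a.f m)
      ((HomologicalComplex.doubleXIso₀ (𝟙 G) (rel_succ m)).inv ≫ b.f (m + 1))
      (by rw [Category.assoc, a.comm]; simp) (by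
        have h1 := HomologicalComplex.congr_hom sq.w m
        simp only [singleToDouble, HomologicalComplex.comp_f,
          HomologicalComplex.mkHomFromSingle_f, Category.assoc] at h1
        rw [Category.assoc, Category.assoc, h1, b.comm, HomologicalComplex.double_d _ _ hm]
        simp)
    refine ⟨⟨⟨HomologicalComplex.mkHomFromDouble (rel_succ m) hm z (z ≫ X.d (m + 1) m) (by simp)
      (by simp), ?_, ?_⟩⟩⟩
    · apply HomologicalComplex.from_single_hom_ext
      simp [singleToDouble, hz]
    · exact double_id_hom_ext G m (by simp [hz'])

lemma hasLiftingProperty_zeroToDouble_iff :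
    HasLiftingProperty (0 : (0 : ChainComplex A ℤ) ⟶
      HomologicalComplex.double (𝟙 G) (rel_succ m)) f ↔
      ∀ (y : G ⟶ Y.X (m + 1)), ∃ x : G ⟶ X.X (m + 1), x ≫ f.f (m + 1) = y := by
  have hm : m + 1 ≠ m := by omega
  constructor
  · intro h y
    have sq : CommSq 0 (0 : (0 : ChainComplex A ℤ) ⟶
        HomologicalComplex.double (𝟙 G) (rel_succ m)) f
        (HomologicalComplex.mkHomFromDouble (rel_succ m) hm y
          (y ≫ Y.d (m + 1) m) (by simp) (by simp)) := ⟨by simp⟩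
    refine ⟨(HomologicalComplex.doubleXIso₀ (𝟙 G) (rel_succ m)).inv ≫ sq.lift.f (m + 1), ?_⟩
    have h1 := HomologicalComplex.congr_hom sq.fac_right (m + 1)
    simp only [HomologicalComplex.comp_f, HomologicalComplex.mkHomFromDouble_f₀] at h1
    rw [Category.assoc, h1]
    simp
  · intro h
    refine ⟨fun {a b} sq => ?_⟩
    obtain ⟨z, hz⟩ := h ((HomologicalComplex.doubleXIso₀ (𝟙 G) (rel_succ m)).inv ≫ b.f (m + 1))
    refine ⟨⟨⟨HomologicalComplex.mkHomFromDouble (rel_succ m) hm z (z ≫ X.d (m + 1) m) (by simp)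
      (by simp), (isZero_zero _).eq_of_src _ _, ?_⟩⟩⟩
    exact double_id_hom_ext G m (by simp [hz])

variable (T : ModuleCat.{0} ℚ ⥤ A) [T.Additive]

/-- The comparison of the disk on `T ℚ` with the image of the disk. -/
def doubleToMapDisk : HomologicalComplex.double (𝟙 (T.obj (ModuleCat.of ℚ ℚ))) (rel_succ m) ⟶
    (T.mapHomologicalComplex _).obj (disk m) :=
  HomologicalComplex.mkHomFromDouble (rel_succ m) (by omega)
    (T.map (HomologicalComplex.doubleXIso₀ (𝟙 (ModuleCat.of ℚ ℚ)) (rel_succ m)).inv)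
    (T.map (HomologicalComplex.doubleXIso₁ (𝟙 (ModuleCat.of ℚ ℚ)) (rel_succ m) (by omega)).inv)
    ((T.map_comp _ _).symm.trans ((congrArg (fun t => T.map t) (by
      rw [HomologicalComplex.double_d _ _ (by omega)]; simp)).trans (Category.id_comp _).symm))
    (fun k _ => (T.map_comp _ _).symm.trans ((congrArg (fun t => T.map t) (by
      rw [HomologicalComplex.double_d_eq_zero₀ _ _ _ _ (by omega), comp_zero])).trans
        (T.map_zero _ _)))

lemma doubleToMapDisk_f₀ : (doubleToMapDisk m T).f (m + 1) =
    (HomologicalComplex.doubleXIso₀ (𝟙 (T.obj (ModuleCat.of ℚ ℚ))) (rel_succ m)).hom ≫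
      T.map (HomologicalComplex.doubleXIso₀ (𝟙 (ModuleCat.of ℚ ℚ)) (rel_succ m)).inv :=
  HomologicalComplex.mkHomFromDouble_f₀ _ _ _ _ _ _

lemma doubleToMapDisk_f₁ : (doubleToMapDisk m T).f m =
    (HomologicalComplex.doubleXIso₁ (𝟙 (T.obj (ModuleCat.of ℚ ℚ))) (rel_succ m) (by omega)).hom ≫
      T.map (HomologicalComplex.doubleXIso₁ (𝟙 (ModuleCat.of ℚ ℚ)) (rel_succ m)
        (by omega)).inv :=
  HomologicalComplex.mkHomFromDouble_f₁ _ _ _ _ _ _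

instance : IsIso (doubleToMapDisk m T) := by
  have hm : m + 1 ≠ m := by omega
  have : ∀ k, IsIso ((doubleToMapDisk m T).f k) := fun k => by
    by_cases h₀ : k = m + 1
    · subst h₀
      exact (congrArg (fun t => IsIso t) (doubleToMapDisk_f₀ m T)).mpr
        (inferInstanceAs (IsIso (_ ≫ T.map _)))
    · by_cases h₁ : k = m
      · subst h₁
        exact (congrArg (fun t => IsIso t) (doubleToMapDisk_f₁ k T)).mpr
          (inferInstanceAs (IsIso (_ ≫ T.map _)))
      · exact IsZero.isIso (HomologicalComplex.isZero_double_X _ _ _ h₀ h₁)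
          (T.map_isZero (HomologicalComplex.isZero_double_X _ (rel_succ m) _ h₀ h₁)) _
  exact HomologicalComplex.Hom.isIso_of_components _

omit [Preadditive A] [HasZeroObject A] [T.Additive] in
lemma comp_map_inv_comp_map_hom {a : A} {b c d : ModuleCat.{0} ℚ} (u : a ⟶ T.obj c) (e : b ≅ c)
    (v : c ⟶ d) : (u ≫ T.map e.inv) ≫ T.map (e.hom ≫ v) = u ≫ T.map v := by
  rw [Category.assoc, ← T.map_comp, Iso.inv_hom_id_assoc]

/-- The image of `S^m → D^{m+1}`. -/
def mapSphereToDiskIso : Arrow.mk (singleToDouble (T.obj (ModuleCat.of ℚ ℚ)) m) ≅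
    Arrow.mk ((T.mapHomologicalComplex _).map (sphereToDisk m)) :=
  Arrow.isoMk ((HomologicalComplex.singleMapHomologicalComplex T _ m).symm.app _)
    (asIso (doubleToMapDisk m T)) (by
      apply HomologicalComplex.from_single_hom_ext
      refine Eq.trans ?_ (congrArg₂ (fun u v => u ≫ v) (singleToDouble_f _ _)
        (doubleToMapDisk_f₁ m T)).symm
      refine (congrArg₂ (fun u v => u ≫ v)
        (HomologicalComplex.singleMapHomologicalComplex_inv_app_self T _ m (ModuleCat.of ℚ ℚ))
        (congrArg (fun t => T.map t) (HomologicalComplex.mkHomFromSingle_f _ _))).trans ?_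
      exact (comp_map_inv_comp_map_hom T _ _ _).trans
        (((Category.assoc _ _ _).trans (congrArg (fun t => _ ≫ t)
          (Iso.inv_hom_id_assoc _ _)))).symm)

/-- The image of `0 → D^{m+1}`. -/
def mapZeroToDiskIso : Arrow.mk (0 : (0 : ChainComplex A ℤ) ⟶
      HomologicalComplex.double (𝟙 (T.obj (ModuleCat.of ℚ ℚ))) (rel_succ m)) ≅
    Arrow.mk ((T.mapHomologicalComplex _).map (zeroToDisk m)) :=
  Arrow.isoMk ((isZero_zero _).iso ((T.mapHomologicalComplex _).map_isZero (isZero_zero _)))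
    (asIso (doubleToMapDisk m T)) ((isZero_zero _).eq_of_src _ _)

end Lifting

/-! ### Lifting properties with respect to the generating sets -/

section Generating

variable {p : ℕ} [Fact p.Prime]

instance : HasZeroObject (AlgModel p) := hasZeroObject_of_hasTerminal_object

instance : HasBinaryBiproducts (AlgModel p) := HasBinaryBiproducts.of_hasBinaryProducts

lemma strMap_tensor_tmul_one {M : AlgModel p} {a : M.left.obj} {x : ∀ k, M.right k}
    (h : strMap M a = toTails M.right x) :
    strMap ((tensor M).obj (ModuleCat.of ℚ ℚ)) (a ⊗ₜ[ℚ] (1 : ℚ) : M.left.obj ⊗[ℚ] ℚ) =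
      toTails (finTensor M.right (ModuleCat.of ℚ ℚ))
        (fun k => (x k ⊗ₜ[ℚ] (1 : ℚ) : M.right k ⊗[ℚ] ℚ)) := by
  change tailsTensor M.right (ModuleCat.of ℚ ℚ) (strMap M a ⊗ₜ (1 : ℚ)) = _
  rw [h]
  rfl

/-- The canonical map `W → W ⊗ ℚ`. -/
def repTensorUnitInv {G : Type} [Group G] (W : Rep.{0} ℚ G) :
    W ⟶ (repTensor W).obj (ModuleCat.of ℚ ℚ) :=
  Rep.ofHom
    { toLinearMap := (TensorProduct.rid ℚ W).symm.toLinearMap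
      isIntertwining' := fun _ => rfl }

/-- The canonical map `W ⊗ ℚ → W`. -/
def repTensorUnitHom {G : Type} [Group G] (W : Rep.{0} ℚ G) :
    (repTensor W).obj (ModuleCat.of ℚ ℚ) ⟶ W :=
  Rep.ofHom
    { toLinearMap := (TensorProduct.rid ℚ W).toLinearMap
      isIntertwining' := fun g => TensorProduct.ext' fun w (q : ℚ) => by
        change TensorProduct.rid ℚ W (W.ρ g w ⊗ₜ q) = W.ρ g (TensorProduct.rid ℚ W (w ⊗ₜ q))
        simp }

/-- The generating maps are built from A(n) ⊗ ℚ; this isomorphism transports to it what is known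
about A(n). -/
lemma nonempty_tensorUnitIso (M : AlgModel p) :
    Nonempty ((tensor M).obj (ModuleCat.of ℚ ℚ) ≅ M) := by
  obtain ⟨u, hu, hu'⟩ := exists_algModel_hom (M := M) (N := (tensor M).obj (ModuleCat.of ℚ ℚ))
    (repTensorUnitInv M.left.obj) (fun k => repTensorUnitInv (M.right k)) (fun a => by
      obtain ⟨x, hx⟩ := exists_strMap_eq M a
      exact ⟨x, hx, strMap_tensor_tmul_one hx⟩)
  obtain ⟨v, hv, hv'⟩ := exists_algModel_hom (M := (tensor M).obj (ModuleCat.of ℚ ℚ)) (N := M)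
    (repTensorUnitHom M.left.obj) (fun k => repTensorUnitHom (M.right k)) (fun t => by
      obtain ⟨x, hx⟩ := exists_strMap_eq M (TensorProduct.rid ℚ M.left.obj t)
      refine ⟨fun k => (x k ⊗ₜ[ℚ] (1 : ℚ) : M.right k ⊗[ℚ] ℚ), ?_,
        hx.trans (congrArg (toTails M.right) (funext fun k => ?_))⟩
      · refine Eq.trans ?_ (strMap_tensor_tmul_one hx)
        exact congrArg _ ((TensorProduct.rid ℚ M.left.obj).symm_apply_apply t).symm
      · exact ((TensorProduct.rid ℚ (M.right k)).apply_symm_apply (x k)).symm)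
  refine ⟨⟨v, u, algModel_hom_ext (fun t => ?_) (fun k t => ?_),
    algModel_hom_ext (fun a => ?_) (fun k x => ?_)⟩⟩
  · rw [atInf_comp, hv, hu]
    exact (TensorProduct.rid ℚ M.left.obj).symm_apply_apply t
  · rw [atFin_comp, hv', hu']
    exact (TensorProduct.rid ℚ (M.right k)).symm_apply_apply t
  · rw [atInf_comp, hu, hv]
    exact (TensorProduct.rid ℚ M.left.obj).apply_symm_apply a
  · rw [atFin_comp, hu', hv']
    exact (TensorProduct.rid ℚ (M.right k)).apply_symm_apply x

/-- The object `A(n) ⊗ ℚ`. -/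
abbrev genTensor (p : ℕ) [Fact p.Prime] (n : ℕ) : AlgModel p :=
  (tensor (gen p n)).obj (ModuleCat.of ℚ ℚ)

instance (n : ℕ) : IsFinitelyPresentable.{0} (genTensor p n) :=
  letI := Cardinal.fact_isRegular_aleph0
  isCardinalPresentable_of_iso (nonempty_tensorUnitIso (gen p n)).some.symm _

lemma exact_map_ev_iff_genTensor (S : ShortComplex (AlgModel p)) :
    (∀ k, (S.map (ev p k)).Exact) ↔ ∀ (n : ℕ) (φ : genTensor p n ⟶ S.X₂), φ ≫ S.g = 0 →
      ∃ ψ : genTensor p n ⟶ S.X₁, ψ ≫ S.f = φ := by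
  rw [exact_map_ev_iff]
  refine forall_congr' fun n => ?_
  let e := (nonempty_tensorUnitIso (gen p n)).some
  constructor
  · intro h φ hφ
    obtain ⟨ψ, hψ⟩ := h (e.inv ≫ φ) (by rw [Category.assoc, hφ, comp_zero])
    exact ⟨e.hom ≫ ψ, by rw [Category.assoc, hψ, e.hom_inv_id_assoc]⟩
  · intro h φ hφ
    obtain ⟨ψ, hψ⟩ := h (e.hom ≫ φ) (by rw [Category.assoc, hφ, comp_zero])
    exact ⟨e.inv ≫ ψ, by rw [Category.assoc, hψ, e.inv_hom_id_assoc]⟩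

lemma exact_map_ev_iff_elements (S : ShortComplex (AlgModel p)) (k : Option ℕ) :
    (S.map (ev p k)).Exact ↔ ∀ y : (ev p k).obj S.X₂, (ev p k).map S.g y = 0 →
      ∃ x, (ev p k).map S.f x = y :=
  ShortComplex.moduleCat_exact_iff _

/-- Surjectivity is exactness of X → Y → 0. -/
lemma surjective_ev_iff {X Y : AlgModel p} (f : X ⟶ Y) :
    (∀ k, Function.Surjective ((ev p k).map f)) ↔
      ∀ (n : ℕ) (y : genTensor p n ⟶ Y), ∃ x, x ≫ f = y := by
  have h := exact_map_ev_iff_genTensor (ShortComplex.mk f (0 : Y ⟶ (0 : AlgModel p)) comp_zero)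
  simp only [exact_map_ev_iff_elements] at h
  constructor
  · intro hf n y
    exact h.1 (fun k y _ => hf k y) n y comp_zero
  · intro hf k y
    exact h.2 (fun n φ _ => hf n φ) k y (by rw [CategoryTheory.Functor.map_zero]; rfl)

/-- The elements of a biproduct. -/
lemma ev_biprod_ext {k : Option ℕ} {X Y : AlgModel p} {a b : (ev p k).obj (X ⊞ Y)}
    (h₁ : (ev p k).map biprod.fst a = (ev p k).map biprod.fst b)
    (h₂ : (ev p k).map biprod.snd a = (ev p k).map biprod.snd b) : a = b := by
  have key : ∀ a : (ev p k).obj (X ⊞ Y), a =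
      (ev p k).map biprod.inl ((ev p k).map biprod.fst a) +
        (ev p k).map biprod.inr ((ev p k).map biprod.snd a) := fun a => by
    have h := congrArg (ev p k).map (biprod.total (X := X) (Y := Y)).symm
    rw [(ev p k).map_id, Functor.map_add, Functor.map_comp, Functor.map_comp] at h
    exact ConcreteCategory.congr_hom h a
  rw [key a, key b, h₁, h₂]

lemma exists_ev_biprod {k : Option ℕ} {X Y : AlgModel p} (x : (ev p k).obj X)
    (y : (ev p k).obj Y) : ∃ a : (ev p k).obj (X ⊞ Y), (ev p k).map biprod.fst a = x ∧
      (ev p k).map biprod.snd a = y := by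
  refine ⟨(ev p k).map biprod.inl x + (ev p k).map biprod.inr y, ?_, ?_⟩
  · rw [map_add, ← ConcreteCategory.comp_apply, ← ConcreteCategory.comp_apply, ← Functor.map_comp,
      ← Functor.map_comp, biprod.inl_fst, biprod.inr_fst, CategoryTheory.Functor.map_id,
      CategoryTheory.Functor.map_zero]
    exact add_zero _
  · rw [map_add, ← ConcreteCategory.comp_apply, ← ConcreteCategory.comp_apply, ← Functor.map_comp,
      ← Functor.map_comp, biprod.inl_snd, biprod.inr_snd, CategoryTheory.Functor.map_id,
      CategoryTheory.Functor.map_zero]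
    exact zero_add _

lemma ev_map_comp_apply {k : Option ℕ} {X Y Z : AlgModel p} (f : X ⟶ Y) (g : Y ⟶ Z)
    (x : (ev p k).obj X) :
    (ev p k).map g ((ev p k).map f x) = (ev p k).map (f ≫ g) x := by
  rw [Functor.map_comp]
  rfl

lemma ev_map_sub_apply {k : Option ℕ} {X Y : AlgModel p} (f g : X ⟶ Y)
    (x : (ev p k).obj X) :
    (ev p k).map (f - g) x = (ev p k).map f x - (ev p k).map g x := by
  rw [Functor.map_sub]
  rfl

variable {X Y : DGAlgModel p} (f : X ⟶ Y)

/-- The map whose image consists of the solvable relative lifting problems in degree `m`. -/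
def liftingIn (m : ℤ) : X.X (m + 1) ⟶ X.X m ⊞ Y.X (m + 1) :=
  biprod.lift (X.d (m + 1) m) (f.f (m + 1))

/-- The map whose kernel consists of the relative lifting problems in degree `m`. -/
def liftingOut (m : ℤ) : X.X m ⊞ Y.X (m + 1) ⟶ X.X (m - 1) ⊞ Y.X m :=
  biprod.lift (biprod.fst ≫ X.d m (m - 1)) (biprod.fst ≫ f.f m - biprod.snd ≫ Y.d (m + 1) m)

lemma liftingIn_fst (m : ℤ) : liftingIn f m ≫ biprod.fst = X.d (m + 1) m := biprod.lift_fst _ _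

lemma liftingIn_snd (m : ℤ) : liftingIn f m ≫ biprod.snd = f.f (m + 1) := biprod.lift_snd _ _

lemma liftingOut_fst (m : ℤ) : liftingOut f m ≫ biprod.fst = biprod.fst ≫ X.d m (m - 1) :=
  biprod.lift_fst _ _

lemma liftingOut_snd (m : ℤ) :
    liftingOut f m ≫ biprod.snd = biprod.fst ≫ f.f m - biprod.snd ≫ Y.d (m + 1) m :=
  biprod.lift_snd _ _

lemma liftingIn_liftingOut (m : ℤ) : liftingIn f m ≫ liftingOut f m = 0 := by
  refine biprod.hom_ext _ _ ?_ ?_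
  · rw [Category.assoc, liftingOut_fst, ← Category.assoc, liftingIn_fst, X.d_comp_d, zero_comp]
  · rw [Category.assoc, liftingOut_snd, Preadditive.comp_sub, ← Category.assoc, ← Category.assoc,
      liftingIn_fst, liftingIn_snd, f.comm, sub_self, zero_comp]

/-- The short complex expressing the relative lifting problem in degree `m`. -/
abbrev liftingComplex (m : ℤ) : ShortComplex (AlgModel p) :=
  ShortComplex.mk (liftingIn f m) (liftingOut f m) (liftingIn_liftingOut f m)

/-- The value of a complex at `k` or at `∞`. -/
abbrev dgEv (p : ℕ) [Fact p.Prime] (k : Option ℕ) :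
    DGAlgModel p ⥤ ChainComplex (ModuleCat.{0} ℚ) ℤ :=
  (ev p k).mapHomologicalComplex _

/-- Kernel elements of the second map are pairs (x, y) with x a cycle and f x = d y; this matches
the criterion of `surjective_and_quasiIso_iff_elements`. -/
lemma liftingComplex_exact_iff (m : ℤ) (k : Option ℕ) :
    ((liftingComplex f m).map (ev p k)).Exact ↔
      ∀ (x : ((dgEv p k).obj X).X m), (∀ j, ((dgEv p k).obj X).d m j x = 0) →
        ∀ y : ((dgEv p k).obj Y).X (m + 1), ((dgEv p k).map f).f m x =
          ((dgEv p k).obj Y).d (m + 1) m y → ∃ z : ((dgEv p k).obj X).X (m + 1),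
            ((dgEv p k).obj X).d (m + 1) m z = x ∧ ((dgEv p k).map f).f (m + 1) z = y := by
  rw [exact_map_ev_iff_elements]
  have hX : ∀ (j : ℤ) (x : (ev p k).obj (X.X m)), (ev p k).map (X.d m (m - 1)) x = 0 →
      (ev p k).map (X.d m j) x = 0 := fun j x hx => by
    by_cases hj : j = m - 1
    · subst hj
      exact hx
    · rw [X.shape _ _ (by simp; omega), CategoryTheory.Functor.map_zero]
      rfl
  have h₁ : ∀ z, (ev p k).map biprod.fst ((ev p k).map (liftingIn f m) z) =
      (ev p k).map (X.d (m + 1) m) z := fun z => by rw [ev_map_comp_apply, liftingIn_fst]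
  have h₂ : ∀ z, (ev p k).map biprod.snd ((ev p k).map (liftingIn f m) z) =
      (ev p k).map (f.f (m + 1)) z := fun z => by rw [ev_map_comp_apply, liftingIn_snd]
  have h₃ : ∀ a, (ev p k).map biprod.fst ((ev p k).map (liftingOut f m) a) =
      (ev p k).map (X.d m (m - 1)) ((ev p k).map biprod.fst a) := fun a => by
    rw [ev_map_comp_apply, ev_map_comp_apply, liftingOut_fst]
  have h₄ : ∀ a, (ev p k).map biprod.snd ((ev p k).map (liftingOut f m) a) =
      (ev p k).map (f.f m) ((ev p k).map biprod.fst a) -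
        (ev p k).map (Y.d (m + 1) m) ((ev p k).map biprod.snd a) := fun a => by
    rw [ev_map_comp_apply, ev_map_comp_apply, ev_map_comp_apply, liftingOut_snd,
      ev_map_sub_apply]
  constructor
  · intro h x hx y hxy
    obtain ⟨a, rfl, rfl⟩ := exists_ev_biprod (X := X.X m) (Y := Y.X (m + 1)) x y
    obtain ⟨z, hz⟩ := h a (ev_biprod_ext
      ((h₃ a).trans ((hx (m - 1)).trans (map_zero _).symm))
      ((h₄ a).trans ((sub_eq_zero.2 hxy).trans (map_zero _).symm)))
    exact ⟨z, (h₁ z).symm.trans (congrArg _ hz), (h₂ z).symm.trans (congrArg _ hz)⟩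
  · intro h a ha
    obtain ⟨z, hz, hz'⟩ := h ((ev p k).map biprod.fst a)
      (fun j => hX j _ ((h₃ a).symm.trans ((congrArg _ ha).trans (map_zero _))))
      ((ev p k).map biprod.snd a)
      (sub_eq_zero.1 ((h₄ a).symm.trans ((congrArg _ ha).trans (map_zero _))))
    exact ⟨z, ev_biprod_ext ((h₁ z).trans hz) ((h₂ z).trans hz')⟩

/-- The same computation with maps from G in place of elements, so that `exact_map_ev_iff_genTensor`
can connect lifting with homology. -/
lemma liftingComplex_exists_iff (m : ℤ) (G : AlgModel p) :
    (∀ φ : G ⟶ (liftingComplex f m).X₂, φ ≫ (liftingComplex f m).g = 0 →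
      ∃ ψ : G ⟶ (liftingComplex f m).X₁, ψ ≫ (liftingComplex f m).f = φ) ↔
    HasLiftingProperty (singleToDouble G m) f := by
  rw [hasLiftingProperty_singleToDouble_iff]
  constructor
  · intro h x y hx hxy
    obtain ⟨z, hz⟩ := h (biprod.lift x y) (by
      refine biprod.hom_ext _ _ ?_ ?_
      · rw [Category.assoc, liftingOut_fst, biprod.lift_fst_assoc, hx, zero_comp]
      · rw [Category.assoc, liftingOut_snd, Preadditive.comp_sub, biprod.lift_fst_assoc,
          biprod.lift_snd_assoc, hxy, sub_self, zero_comp])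
    refine ⟨z, ?_, ?_⟩
    · rw [← liftingIn_fst f m, ← Category.assoc, hz, biprod.lift_fst]
    · rw [← liftingIn_snd f m, ← Category.assoc, hz, biprod.lift_snd]
  · intro h φ hφ
    obtain ⟨z, hz, hz'⟩ := h (φ ≫ biprod.fst) (φ ≫ biprod.snd)
      (by rw [Category.assoc, ← liftingOut_fst f m, ← Category.assoc, hφ, zero_comp])
      (by rw [← sub_eq_zero, Category.assoc, Category.assoc, ← Preadditive.comp_sub,
        ← liftingOut_snd f m, ← Category.assoc, hφ, zero_comp])
    refine ⟨z, biprod.hom_ext _ _ ?_ ?_⟩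
    · rw [Category.assoc, liftingIn_fst, hz]
    · rw [Category.assoc, liftingIn_snd, hz']

lemma isHomologyIso_iff : IsHomologyIso f ↔ ∀ k, QuasiIso ((dgEv p k).map f) :=
  ⟨fun h k => match k with
    | none => h.2
    | some k => h.1 k, fun h => ⟨fun k => h (some k), h none⟩⟩

lemma isSurjection_iff :
    IsSurjection f ↔ ∀ k i, Function.Surjective (((dgEv p k).map f).f i) :=
  ⟨fun h k => match k with
    | none => h.2
    | some k => h.1 k, fun h => ⟨fun k => h (some k), h none⟩⟩

lemma rlp_ofHoms_iff {C : Type*} [Category* C] {ι : Type*} {A B : ι → C} (i : ∀ j, A j ⟶ B j)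
    {X Y : C} (f : X ⟶ Y) :
    (MorphismProperty.ofHoms i).rlp f ↔ ∀ j, HasLiftingProperty (i j) f :=
  ⟨fun h j => h _ ⟨j⟩, fun h _ _ _ hi => by obtain ⟨j⟩ := hi; exact h j⟩

lemma genCof_rlp_iff_singleToDouble : (genCof p).rlp f ↔
    ∀ (n : ℕ) (m : ℤ), HasLiftingProperty (singleToDouble (genTensor p n) m) f := by
  rw [genCof, rlp_ofHoms_iff, Prod.forall]
  exact forall_congr' fun n => forall_congr' fun m =>
    (HasLiftingProperty.iff_of_arrow_iso_left (mapSphereToDiskIso m (tensor (gen p n))) f).symm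

lemma rlp_genCof_iff : (genCof p).rlp f ↔ IsSurjection f ∧ IsHomologyIso f := by
  rw [genCof_rlp_iff_singleToDouble, isHomologyIso_iff, isSurjection_iff, ← forall_and]
  simp only [surjective_and_quasiIso_iff_elements, ← liftingComplex_exact_iff,
    ← liftingComplex_exists_iff]
  rw [forall_comm, forall_comm (α := Option ℕ)]
  exact forall_congr' fun m => (exact_map_ev_iff_genTensor (liftingComplex f m)).symm

lemma rlp_genAcyclicCof_iff : (genAcyclicCof p).rlp f ↔ IsSurjection f := by
  have h₁ : (genAcyclicCof p).rlp f ↔ ∀ (n : ℕ) (m : ℤ)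
      (y : genTensor p n ⟶ Y.X (m + 1)), ∃ x, x ≫ f.f (m + 1) = y := by
    rw [genAcyclicCof, rlp_ofHoms_iff, Prod.forall]
    exact forall_congr' fun n => forall_congr' fun m =>
      (HasLiftingProperty.iff_of_arrow_iso_left
        (mapZeroToDiskIso m (tensor (gen p n))) f).symm.trans
          (hasLiftingProperty_zeroToDouble_iff f _ m)
  rw [h₁, isSurjection_iff, forall_comm, forall_comm (α := Option ℕ)]
  have h₂ : ∀ i, (∀ k, Function.Surjective (((dgEv p k).map f).f i)) ↔
    ∀ (n : ℕ) (y : genTensor p n ⟶ Y.X i), ∃ x, x ≫ f.f i = y :=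
      fun i => surjective_ev_iff (f.f i)
  simp only [h₂]
  refine ⟨fun h i => ?_, fun h m => h (m + 1)⟩
  obtain ⟨m, rfl⟩ : ∃ m, i = m + 1 := ⟨i - 1, by omega⟩
  exact h m

end Generating

/-! ### The small object argument -/

section Small

lemma isFinitelyPresentable_zero {C : Type*} [Category.{0} C] [Preadditive C] {X : C}
    (hX : IsZero X) : IsFinitelyPresentable.{0} X := by
  refine isFinitelyPresentable_of_exists X (fun {J _ _ F c} _ f => ?_) (fun _ j f _ => ?_)
  · exact ⟨IsFiltered.nonempty.some, 0, hX.eq_of_src _ _⟩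
  · exact ⟨j, 𝟙 j, hX.eq_of_src _ _⟩

section

variable {A : Type*} [Category.{0} A] [Preadditive A] [HasColimits A] (G : A)
  [IsFinitelyPresentable.{0} G] {J : Type} [SmallCategory J] [IsFiltered J]
  {F : J ⥤ ChainComplex A ℤ} {c : Cocone F} (hc : IsColimit c)

include hc

lemma exists_comp_ι_f_eq {m : ℤ} (x : G ⟶ c.pt.X m) :
    ∃ (j : J) (y : G ⟶ (F.obj j).X m), y ≫ (c.ι.app j).f m = x :=
  IsFinitelyPresentable.exists_hom_of_isColimit.{0}
    (isColimitOfPreserves (HomologicalComplex.eval A (ComplexShape.down ℤ) m) hc) x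

lemma exists_comp_map_f_eq_zero {m : ℤ} {j : J} {x : G ⟶ (F.obj j).X m}
    (hx : x ≫ (c.ι.app j).f m = 0) : ∃ (j' : J) (u : j ⟶ j'), x ≫ (F.map u).f m = 0 := by
  obtain ⟨j', u, v, hu⟩ := IsFinitelyPresentable.exists_eq_of_isColimit.{0}
    (isColimitOfPreserves (HomologicalComplex.eval A (ComplexShape.down ℤ) m) hc) (i := j)
    (j := j) x (0 : G ⟶ (F.obj j).X m) (hx.trans zero_comp.symm)
  exact ⟨j', u, hu.trans zero_comp⟩

end

/-- A map from the sphere is a cycle G → X_m. It factors through some stage as a mere map, and its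
boundary vanishes at a later one. -/
lemma isFinitelyPresentable_single {A : Type*} [Category.{0} A] [Preadditive A] [HasZeroObject A]
    [HasColimits A] (G : A) [IsFinitelyPresentable.{0} G] (m : ℤ) : IsFinitelyPresentable.{0}
      ((HomologicalComplex.single A (ComplexShape.down ℤ) m).obj G) := by
  refine isFinitelyPresentable_of_exists _ (fun {J _ _ F c} hc f => ?_)
    (fun {J _ _ F c} hc j f hf => ?_)
  · obtain ⟨j, x, hx⟩ := exists_comp_ι_f_eq G hc
      ((HomologicalComplex.singleObjXSelf _ m G).inv ≫ f.f m)
    obtain ⟨j', u, hu⟩ := exists_comp_map_f_eq_zero G hc (x := x ≫ (F.obj j).d m (m - 1)) (by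
      rw [Category.assoc, ← (c.ι.app j).comm, ← Category.assoc, hx]
      exact (Category.assoc _ _ _).trans ((congrArg _ (f.comm _ _)).trans (by simp)))
    refine ⟨j', HomologicalComplex.mkHomFromSingle (x ≫ (F.map u).f m) (fun k _ =>
      comp_d_eq_zero G m (by
        rw [Category.assoc, (F.map u).comm, ← Category.assoc, hu]) k), ?_⟩
    apply HomologicalComplex.from_single_hom_ext
    have h : (F.map u).f m ≫ (c.ι.app j').f m = (c.ι.app j).f m :=
      HomologicalComplex.congr_hom (c.w u) m
    rw [HomologicalComplex.comp_f, HomologicalComplex.mkHomFromSingle_f, Category.assoc,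
      Category.assoc, h, hx, Iso.hom_inv_id_assoc]
  · obtain ⟨j', u, hu⟩ := exists_comp_map_f_eq_zero G hc
      (x := (HomologicalComplex.singleObjXSelf _ m G).inv ≫ f.f m) (by
        have h : f.f m ≫ (c.ι.app j).f m = 0 := HomologicalComplex.congr_hom hf m
        rw [Category.assoc, h, comp_zero])
    refine ⟨j', u, HomologicalComplex.from_single_hom_ext ?_⟩
    rw [Category.assoc] at hu
    exact (Iso.cancel_iso_inv_left _ _ _).1 (hu.trans comp_zero.symm)

variable (p : ℕ) [Fact p.Prime]

instance (n : ℕ) (m : ℤ) : IsFinitelyPresentable.{0} ((dgTensor (gen p n)).obj (sphere m)) :=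
  letI := Cardinal.fact_isRegular_aleph0
  haveI : IsFinitelyPresentable.{0} ((tensor (gen p n) ⋙
      HomologicalComplex.single (AlgModel p) (ComplexShape.down ℤ) m).obj (ModuleCat.of ℚ ℚ)) :=
    isFinitelyPresentable_single (genTensor p n) m
  isCardinalPresentable_of_iso ((HomologicalComplex.singleMapHomologicalComplex
    (tensor (gen p n)) _ m).symm.app (ModuleCat.of ℚ ℚ)) _

instance (n : ℕ) : IsFinitelyPresentable.{0}
    ((dgTensor (gen p n)).obj (0 : ChainComplex (ModuleCat.{0} ℚ) ℤ)) :=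
  isFinitelyPresentable_zero (Functor.map_isZero _ (isZero_zero _))

/-- Only the sources need to be small; finite presentability lets ℵ₀ serve as the cardinal. -/
lemma hasSmallObjectArgument_of_isFinitelyPresentable {C : Type*} [Category.{0} C] [HasColimits C]
    {ι : Type} {A B : ι → C} (i : ∀ j, A j ⟶ B j) [∀ j, IsFinitelyPresentable.{0} (A j)] :
    MorphismProperty.HasSmallObjectArgument.{0} (MorphismProperty.ofHoms i) := by
  let := Cardinal.fact_isRegular_aleph0
  let := Cardinal.orderBotAleph0OrdToType
  have : MorphismProperty.IsSmall.{0} (MorphismProperty.ofHoms i) :=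
    MorphismProperty.isSmall_ofHoms i
  have : (MorphismProperty.ofHoms i).IsCardinalForSmallObjectArgument Cardinal.aleph0.{0} :=
    { preservesColimit := fun {A' B' X Y} i' hi f hf => by
        have : IsFinitelyPresentable.{0} A' := by
          obtain ⟨j⟩ := hi
          infer_instance
        infer_instance }
  exact ⟨.aleph0, inferInstance, inferInstance, inferInstance⟩

instance : MorphismProperty.HasSmallObjectArgument.{0} (genCof p) :=
  hasSmallObjectArgument_of_isFinitelyPresentable _

instance : MorphismProperty.HasSmallObjectArgument.{0} (genAcyclicCof p) :=
  hasSmallObjectArgument_of_isFinitelyPresentable _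

end Small

/-! ### Cones on graded objects -/

section Cone

variable {A : Type*} [Category* A] [Preadditive A] [HasBinaryBiproducts A]

/-- The cone on a graded object, with the differential `(a, b) ↦ (0, a)`. -/
def gradedCone (B : ℤ → A) : ChainComplex A ℤ where
  X n := B n ⊞ B (n + 1)
  d i j := if h : j + 1 = i then biprod.fst ≫ eqToHom (congrArg B h.symm) ≫ biprod.inr else 0
  shape i j h := dif_neg h
  d_comp_d' i j k h h' := by
    obtain rfl : j + 1 = i := h
    obtain rfl : k + 1 = j := h'
    simp

lemma gradedCone_d (B : ℤ → A) (n : ℤ) :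
    (gradedCone B).d (n + 1) n = (biprod.fst : B (n + 1) ⊞ B (n + 1 + 1) ⟶ _) ≫ biprod.inr := by
  simp [gradedCone]

variable (Y : ChainComplex A ℤ)

/-- The canonical map to a complex from the cone on its underlying graded object. -/
def fromGradedCone : gradedCone Y.X ⟶ Y where
  f n := biprod.desc (𝟙 _) (Y.d (n + 1) n)
  comm' i j h := by
    obtain rfl : j + 1 = i := h
    rw [gradedCone_d]
    change biprod.desc (𝟙 (Y.X (j + 1))) (Y.d (j + 1 + 1) (j + 1)) ≫ Y.d (j + 1) j =
      (biprod.fst ≫ biprod.inr) ≫ biprod.desc (𝟙 (Y.X j)) (Y.d (j + 1) j)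
    exact biprod.hom_ext' _ _ (by simp) (by simp)

lemma exists_section_fromGradedCone (n : ℤ) : ∃ s, s ≫ (fromGradedCone Y).f n = 𝟙 (Y.X n) :=
  ⟨(biprod.inl : Y.X n ⟶ Y.X n ⊞ Y.X (n + 1)), biprod.inl_desc _ _⟩

/-- The canonical map from a complex to the cone on its shifted underlying graded object. -/
def toGradedCone : Y ⟶ gradedCone (fun n => Y.X (n - 1)) where
  f n := biprod.lift (Y.d n (n - 1)) (Y.XIsoOfEq (by omega : n = n + 1 - 1)).hom
  comm' i j h := by
    obtain rfl : j + 1 = i := h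
    rw [gradedCone_d]
    change biprod.lift _ (Y.XIsoOfEq (by omega : j + 1 = j + 1 + 1 - 1)).hom ≫
      (biprod.fst ≫ biprod.inr) = Y.d (j + 1) j ≫ biprod.lift _
        (Y.XIsoOfEq (by omega : j = j + 1 - 1)).hom
    exact biprod.hom_ext _ _ (by simp) (by simp)

lemma exists_retraction_toGradedCone (n : ℤ) : ∃ r, (toGradedCone Y).f n ≫ r = 𝟙 (Y.X n) := by
  refine ⟨(biprod.snd ≫ (Y.XIsoOfEq (by omega : n = n + 1 - 1)).inv :
    Y.X (n - 1) ⊞ Y.X (n + 1 - 1) ⟶ _), ?_⟩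
  change biprod.lift _ (Y.XIsoOfEq (by omega : n = n + 1 - 1)).hom ≫ biprod.snd ≫ _ = _
  rw [biprod.lift_snd_assoc, Iso.hom_inv_id]

variable [HasZeroObject A]

/-- The cone is contractible: a cycle has the form (0, b), and it is the boundary of (b, 0). -/
lemma hasLiftingProperty_gradedCone (B : ℤ → A) (G : A) (m : ℤ) :
    HasLiftingProperty (singleToDouble G m) (0 : gradedCone B ⟶ 0) := by
  rw [hasLiftingProperty_singleToDouble_iff]
  intro x y hx _
  obtain ⟨m, rfl⟩ : ∃ n, m = n + 1 := ⟨m - 1, by omega⟩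
  change G ⟶ B (m + 1) ⊞ B (m + 1 + 1) at x
  replace hx : x ≫ (biprod.fst ≫ biprod.inr : B (m + 1) ⊞ B (m + 1 + 1) ⟶ B m ⊞ B (m + 1)) = 0 :=
    (congrArg (x ≫ ·) (gradedCone_d B m).symm).trans (comp_d_eq_zero (X := gradedCone B) G (m + 1) hx m)
  replace hx : x ≫ biprod.fst = 0 := by simpa using hx =≫ biprod.snd
  refine ⟨(x ≫ biprod.snd ≫ biprod.inl : G ⟶ B (m + 1 + 1) ⊞ B (m + 1 + 1 + 1)), ?_,
    ((HomologicalComplex.eval A (ComplexShape.down ℤ) _).map_isZero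
      (isZero_zero (ChainComplex A ℤ))).eq_of_tgt _ _⟩
  rw [gradedCone_d]
  change (x ≫ biprod.snd ≫ biprod.inl) ≫ biprod.fst ≫ biprod.inr = x
  exact biprod.hom_ext _ _ (by simp [hx]) (by simp)

end Cone

/-! ### Cofibrations and acyclic cofibrations -/

section Cofibrations

variable {p : ℕ} [Fact p.Prime]

lemma genCof_rlp_gradedCone (B : ℤ → AlgModel p) : (genCof p).rlp (0 : gradedCone B ⟶ 0) :=
  (genCof_rlp_iff_singleToDouble _).2 fun _ _ => hasLiftingProperty_gradedCone _ _ _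

lemma isHomologyIso_comp {X Y Z : DGAlgModel p} {f : X ⟶ Y} {g : Y ⟶ Z} (hf : IsHomologyIso f)
    (hg : IsHomologyIso g) : IsHomologyIso (f ≫ g) := by
  rw [isHomologyIso_iff] at hf hg ⊢
  intro k
  have := hf k
  have := hg k
  rw [Functor.map_comp]
  infer_instance

lemma isHomologyIso_of_comp_right {X Y Z : DGAlgModel p} {f : X ⟶ Y} {g : Y ⟶ Z}
    (hg : IsHomologyIso g) (h : IsHomologyIso (f ≫ g)) : IsHomologyIso f := by
  rw [isHomologyIso_iff] at hg h ⊢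
  intro k
  have := hg k
  have := h k
  rw [Functor.map_comp] at this
  exact quasiIso_of_comp_right _ ((dgEv p k).map g)

lemma isHomologyIso_of_comp_left {X Y Z : DGAlgModel p} {f : X ⟶ Y} {g : Y ⟶ Z}
    (hf : IsHomologyIso f) (h : IsHomologyIso (f ≫ g)) : IsHomologyIso g := by
  rw [isHomologyIso_iff] at hf h ⊢
  intro k
  have := hf k
  have := h k
  rw [Functor.map_comp] at this
  exact quasiIso_of_comp_left ((dgEv p k).map f) _

lemma isHomologyIso_id (X : DGAlgModel p) : IsHomologyIso (𝟙 X) := by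
  rw [isHomologyIso_iff]
  intro k
  rw [CategoryTheory.Functor.map_id]
  infer_instance

lemma isHomologyIso_of_retractArrow {X Y X' Y' : DGAlgModel p} {f : X ⟶ Y} {g : X' ⟶ Y'}
    (h : RetractArrow f g) (hg : IsHomologyIso g) : IsHomologyIso f := by
  rw [isHomologyIso_iff] at hg ⊢
  intro k
  have := hg k
  exact quasiIso_of_retractArrow (h.map (dgEv p k))

lemma isSurjection_of_section {X Y : DGAlgModel p} (f : X ⟶ Y)
    (hf : ∀ n, ∃ s, s ≫ f.f n = 𝟙 (Y.X n)) : IsSurjection f := by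
  rw [isSurjection_iff]
  intro k n y
  obtain ⟨s, hs⟩ := hf n
  refine ⟨(ev p k).map s y, (ev_map_comp_apply s (f.f n) y).trans ?_⟩
  rw [hs, CategoryTheory.Functor.map_id]
  rfl

/-- The projection to X is a base change of cone → 0, hence a surjective homology isomorphism, and
`biprod.inl` is a section of it. -/
lemma isHomologyIso_inl (X : DGAlgModel p) (B : ℤ → AlgModel p) :
    IsHomologyIso (biprod.inl : X ⟶ X ⊞ gradedCone B) := by
  have h : (genCof p).rlp (biprod.fst : X ⊞ gradedCone B ⟶ X) :=
    MorphismProperty.of_isPullback (IsPullback.of_has_biproduct X (gradedCone B)).flip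
      (genCof_rlp_gradedCone B)
  refine isHomologyIso_of_comp_right ((rlp_genCof_iff _).1 h).2 ?_
  rw [biprod.inl_fst]
  exact isHomologyIso_id X

/-- Adding the cone on Y makes f a degreewise split surjection X ⊕ cone → Y. Lifting the identity of
Y against it exhibits f as a retract of X → X ⊕ cone. -/
lemma isHomologyIso_of_llp {X Y : DGAlgModel p} {f : X ⟶ Y}
    (hf : (genAcyclicCof p).rlp.llp f) : IsHomologyIso f := by
  have hq : IsSurjection (biprod.desc f (fromGradedCone Y)) :=
    isSurjection_of_section _ fun n => by
      obtain ⟨s, hs⟩ := exists_section_fromGradedCone Y n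
      exact ⟨s ≫ (biprod.inr : gradedCone Y.X ⟶ X ⊞ gradedCone Y.X).f n, by
        rw [Category.assoc, ← HomologicalComplex.comp_f, biprod.inr_desc, hs]⟩
  have := hf _ ((rlp_genAcyclicCof_iff _).2 hq)
  have sq : CommSq biprod.inl f (biprod.desc f (fromGradedCone Y)) (𝟙 Y) :=
    ⟨by rw [biprod.inl_desc, Category.comp_id]⟩
  exact isHomologyIso_of_retractArrow
    { i := Arrow.homMk (𝟙 X) sq.lift
      r := Arrow.homMk (𝟙 X) (biprod.desc f (fromGradedCone Y)) }
    (isHomologyIso_inl X Y.X)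

/-- The degreewise split embedding of X into a contractible cone extends along i, so i is degreewise
split as well. -/
lemma exists_retraction_of_llp {X Y : DGAlgModel p} {i : X ⟶ Y} (hi : (genCof p).rlp.llp i)
    (n : ℤ) : ∃ r, i.f n ≫ r = 𝟙 (X.X n) := by
  have := hi _ (genCof_rlp_gradedCone fun n => X.X (n - 1))
  have sq : CommSq (toGradedCone X) i
    (0 : gradedCone (fun n => X.X (n - 1)) ⟶ 0) (0 : Y ⟶ 0) := ⟨by simp⟩
  obtain ⟨r, hr⟩ := exists_retraction_toGradedCone X n
  refine ⟨sq.lift.f n ≫ r, ?_⟩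
  rw [← Category.assoc, ← HomologicalComplex.comp_f, sq.fac_left, hr]

end Cofibrations

/-! ### Properness -/

section Proper

/-! ### Element chases for pushouts and pullbacks of complexes of vector spaces. -/

section Elements

variable {A B X Y : ChainComplex (ModuleCat.{0} ℚ) ℤ}

lemma forall_d_eq_zero {n : ℤ} {x : A.X (n + 1)} (hx : A.d (n + 1) n x = 0) (j : ℤ) :
    A.d (n + 1) j x = 0 := by
  by_cases hj : j = n
  · subst hj
    exact hx
  · rw [A.shape _ _ (by simp; omega)]
    rfl

lemma quasiIso_of_pushout_elements (w : A ⟶ X) (i : A ⟶ B) (i' : X ⟶ Y) (w' : B ⟶ Y)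
    (comm : ∀ n a, i'.f n (w.f n a) = w'.f n (i.f n a))
    (hi : ∀ n, Function.Injective (i.f n)) (hY : ∀ n y, ∃ x b, y = i'.f n x + w'.f n b)
    (hA : ∀ n x b, i'.f n x + w'.f n b = 0 → ∃ a, x = w.f n a ∧ b = -i.f n a)
    (hw : QuasiIso w) : QuasiIso w' := by
  obtain ⟨hw₁, hw₂⟩ := (quasiIso_iff_elements w).1 hw
  refine (quasiIso_iff_elements w').2 ⟨fun m b hb y hby => ?_, fun m y hy => ?_⟩
  · obtain ⟨x, b₁, rfl⟩ := hY _ y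
    -- The relation `w' b = d y` lies in the kernel of X ⊕ B → Y and so comes from some `a`. It is a
    -- cycle by injectivity of `i`, and a boundary because `w a = d (-x)`.
    obtain ⟨a, hxa, hba⟩ := hA m (-X.d (m + 1) m x) (b - B.d (m + 1) m b₁) (by
      rw [map_neg, map_sub, hby, f_d_apply, f_d_apply, map_add]
      abel)
    obtain ⟨a', rfl⟩ := hw₁ m a (fun j => hi j (by
        rw [f_d_apply, ← neg_eq_iff_eq_neg.2 hba, map_neg, map_sub, hb, d_d_apply, map_zero,
          sub_zero, neg_zero])) (-x) (by rw [← hxa, map_neg])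
    refine ⟨b₁ - i.f (m + 1) a', ?_⟩
    rw [map_sub, ← f_d_apply, sub_eq_iff_eq_add, ← sub_eq_iff_eq_add', ← neg_sub, hba, neg_neg]
  · obtain ⟨n, rfl⟩ : ∃ n, m = n + 1 := ⟨m - 1, by omega⟩
    obtain ⟨x, b, rfl⟩ := hY _ y
    obtain ⟨a, hxa, hba⟩ := hA n (X.d (n + 1) n x) (B.d (n + 1) n b) (by
      rw [f_d_apply, f_d_apply, ← map_add, hy])
    obtain ⟨a', rfl⟩ := hw₁ n a (fun j => hi j (by
      rw [f_d_apply, ← neg_eq_iff_eq_neg.2 hba, map_neg, d_d_apply, map_zero, neg_zero])) x hxa.symm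
    -- Correcting `x` by `w a'` makes it a cycle, which is homologous to the image of a cycle of A;
    -- both corrections move to B through `i`.
    obtain ⟨a'', ha'', x', hx'⟩ := hw₂ (n + 1) (x - w.f (n + 1) a') (forall_d_eq_zero (by
      rw [map_sub, hxa, f_d_apply, sub_self]))
    refine ⟨b + i.f (n + 1) a' + i.f (n + 1) a'', forall_d_eq_zero ?_, i'.f _ x', ?_⟩
    · rw [map_add, map_add, ← f_d_apply, ← f_d_apply, hba, ha'', map_zero]
      abel
    · rw [sub_eq_iff_eq_add] at hx'
      rw [hx', map_add, map_add, map_add, map_add, ← comm, ← comm, ← f_d_apply]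
      abel

lemma quasiIso_of_pullback_elements (w' : A ⟶ B) (q : A ⟶ X) (f : B ⟶ Y) (w : X ⟶ Y)
    (comm : ∀ n a, f.f n (w'.f n a) = w.f n (q.f n a))
    (hf : ∀ n, Function.Surjective (f.f n))
    (hA : ∀ n a, w'.f n a = 0 → q.f n a = 0 → a = 0)
    (hA' : ∀ n b x, f.f n b = w.f n x → ∃ a, w'.f n a = b ∧ q.f n a = x)
    (hw : QuasiIso w) : QuasiIso w' := by
  obtain ⟨hw₁, hw₂⟩ := (quasiIso_iff_elements w).1 hw
  refine (quasiIso_iff_elements w').2 ⟨fun m a ha b hab => ?_, fun m b hb => ?_⟩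
  · obtain ⟨x, hx⟩ := hw₁ m (q.f m a) (fun j => by rw [← f_d_apply, ha, map_zero])
      (f.f (m + 1) b) (by rw [← comm, hab, f_d_apply])
    -- The elements `x` and `b` need not agree in Y. Their difference is a cycle, removed by
    -- changing `x` by a cycle and `b` by a boundary, the latter using surjectivity of `f`.
    obtain ⟨x₂, hx₂, y, hy⟩ := hw₂ (m + 1) (w.f (m + 1) x - f.f (m + 1) b) (forall_d_eq_zero (by
      rw [map_sub, ← f_d_apply, ← f_d_apply, hx, ← comm, hab, sub_self]))
    obtain ⟨b₂, rfl⟩ := hf _ y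
    obtain ⟨a₁, ha₁, ha₁'⟩ := hA' (m + 1) (b + B.d _ _ b₂) (x - x₂) (by
      rw [map_add, map_sub, f_d_apply, sub_eq_iff_eq_add.1 hy]
      abel)
    refine ⟨a₁, sub_eq_zero.1 (hA _ _ ?_ ?_)⟩
    · rw [map_sub, f_d_apply, ha₁, map_add, d_d_apply, hab, add_zero, sub_self]
    · rw [map_sub, f_d_apply, ha₁', map_sub, hx, hx₂, sub_zero, sub_self]
  · obtain ⟨x, hx, y, hy⟩ := hw₂ m (f.f m b) (fun j => by rw [← f_d_apply, hb, map_zero])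
    obtain ⟨b₁, rfl⟩ := hf _ y
    obtain ⟨a, ha, ha'⟩ := hA' m (b - B.d _ _ b₁) x (by
      rw [map_sub, hy, f_d_apply, add_sub_cancel_right])
    refine ⟨a, fun j => hA _ _ ?_ ?_, b₁, ?_⟩
    · rw [f_d_apply, ha, map_sub, hb, d_d_apply, sub_zero]
    · rw [f_d_apply, ha', hx]
    · rw [ha, sub_add_cancel]

end Elements

/-! ### Pushout squares of vector spaces. -/

section Squares

variable {A B X Y : ModuleCat.{0} ℚ} {w : A ⟶ X} {i : A ⟶ B} {i' : X ⟶ Y} {w' : B ⟶ Y}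
  (h : IsPushout w i i' w')

include h

/-- The quotient of Y by the sum of the two images receives the zero map, by uniqueness in the
universal property. -/
lemma exists_eq_add_of_isPushout (y : Y) : ∃ x b, y = i' x + w' b := by
  let R := LinearMap.range i'.hom ⊔ LinearMap.range w'.hom
  have hR : ModuleCat.ofHom R.mkQ = 0 := by
    refine h.hom_ext ?_ ?_
    · ext x
      exact (Submodule.Quotient.mk_eq_zero R).2 (Submodule.mem_sup_left ⟨x, rfl⟩)
    · ext b
      exact (Submodule.Quotient.mk_eq_zero R).2 (Submodule.mem_sup_right ⟨b, rfl⟩)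
  have hy : y ∈ R := (Submodule.Quotient.mk_eq_zero R).1 (ConcreteCategory.congr_hom hR y)
  obtain ⟨_, ⟨x, rfl⟩, _, ⟨b, rfl⟩, hxb⟩ := Submodule.mem_sup.1 hy
  exact ⟨x, b, hxb.symm⟩

/-- Comparison with the explicit pushout, the quotient of X × B by the pairs (w a, -i a). -/
lemma exists_of_isPushout {x : X} {b : B} (hxb : i' x + w' b = 0) :
    ∃ a, x = w a ∧ b = -i a := by
  let R : Submodule ℚ (X × B) := LinearMap.range (w.hom.prod (-i.hom))
  let u : X ⟶ ModuleCat.of ℚ ((X × B) ⧸ R) := ModuleCat.ofHom (R.mkQ ∘ₗ LinearMap.inl ℚ X B)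
  let v : B ⟶ ModuleCat.of ℚ ((X × B) ⧸ R) := ModuleCat.ofHom (R.mkQ ∘ₗ LinearMap.inr ℚ X B)
  have huv : w ≫ u = i ≫ v := by
    ext a
    refine (Submodule.Quotient.eq R).2 ⟨a, ?_⟩
    exact Prod.ext (sub_zero _).symm (zero_sub _).symm
  have h₁ := ConcreteCategory.congr_hom (h.inl_desc u v huv) x
  have h₂ := ConcreteCategory.congr_hom (h.inr_desc u v huv) b
  have h₃ : u x + v b = 0 := by
    rw [← h₁, ← h₂]
    exact (map_add (h.desc u v huv).hom _ _).symm.trans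
      ((congrArg (h.desc u v huv).hom hxb).trans (map_zero (h.desc u v huv).hom))
  obtain ⟨a, ha⟩ := (Submodule.Quotient.mk_eq_zero R).1
    ((R.mkQ.map_add (x, 0) (0, b)).trans h₃)
  refine ⟨a, ?_, ?_⟩
  · simpa using (congrArg Prod.fst ha).symm
  · simpa using (congrArg Prod.snd ha).symm

end Squares

variable {p : ℕ} [Fact p.Prime]

lemma exists_ev_map_eq {X Y Z : AlgModel p} {f : X ⟶ Y} {g : Y ⟶ Z} (w : f ≫ g = 0)
    (h : ∀ (n : ℕ) (φ : gen p n ⟶ Y), φ ≫ g = 0 → ∃ ψ, ψ ≫ f = φ) {k : Option ℕ}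
    {y : (ev p k).obj Y} (hy : (ev p k).map g y = 0) : ∃ x, (ev p k).map f x = y :=
  (exact_map_ev_iff_elements (ShortComplex.mk f g w) k).1
    ((exact_map_ev_iff (ShortComplex.mk f g w)).2 h k) y hy

/-! ### Elements of pullbacks in 𝓐(ℤ_p). -/

section Pullback

variable {A B X Y : AlgModel p} {w' : A ⟶ B} {q : A ⟶ X} {f : B ⟶ Y} {w : X ⟶ Y}
  (h : IsPullback w' q f w) (k : Option ℕ)

include h

/-- The universal property makes Hom(A(n), -) exact on 0 → A → B ⊕ X, so evaluation is exact there;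
no description of limits is needed. -/
lemma eq_zero_of_isPullback {a : (ev p k).obj A} (h₁ : (ev p k).map w' a = 0)
    (h₂ : (ev p k).map q a = 0) : a = 0 := by
  have ha : (ev p k).map (biprod.lift w' q) a = 0 := ev_biprod_ext
    (by rw [ev_map_comp_apply, biprod.lift_fst, h₁, map_zero])
    (by rw [ev_map_comp_apply, biprod.lift_snd, h₂, map_zero])
  have H := exists_ev_map_eq (f := (0 : (0 : AlgModel p) ⟶ A)) zero_comp
    (fun n φ hφ => ⟨0, zero_comp.trans (h.hom_ext ?_ ?_).symm⟩) ha
  · obtain ⟨x, rfl⟩ := H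
    rw [(ev p k).map_zero]
    rfl
  · rw [zero_comp, ← biprod.lift_fst w' q, ← Category.assoc, hφ, zero_comp]
  · rw [zero_comp, ← biprod.lift_snd w' q, ← Category.assoc, hφ, zero_comp]

/-- The same argument for A → B ⊕ X → Y. -/
lemma exists_of_isPullback {b : (ev p k).obj B} {x : (ev p k).obj X}
    (hbx : (ev p k).map f b = (ev p k).map w x) :
    ∃ a, (ev p k).map w' a = b ∧ (ev p k).map q a = x := by
  obtain ⟨c, rfl, rfl⟩ := exists_ev_biprod b x
  have hc : (ev p k).map (biprod.fst ≫ f - biprod.snd ≫ w) c = 0 := by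
    rw [ev_map_sub_apply, ← ev_map_comp_apply, ← ev_map_comp_apply, hbx, sub_self]
  have H := exists_ev_map_eq (f := biprod.lift w' q) (by simp [h.w]) (fun n φ hφ => ?_) hc
  · obtain ⟨a, rfl⟩ := H
    refine ⟨a, ?_, ?_⟩
    · rw [ev_map_comp_apply, biprod.lift_fst]
    · rw [ev_map_comp_apply, biprod.lift_snd]
  · rw [Preadditive.comp_sub, sub_eq_zero] at hφ
    refine ⟨h.lift (φ ≫ biprod.fst) (φ ≫ biprod.snd) (by simpa using hφ), ?_⟩
    exact biprod.hom_ext _ _ (by simp) (by simp)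

end Pullback

/-- Evaluation preserves colimits, so each degree gives a pushout of vector spaces; `i` is injective
there by its degreewise retraction. -/
lemma isHomologyIso_of_isPushout {A B X Y : DGAlgModel p} {w : A ⟶ X} {i : A ⟶ B} {i' : X ⟶ Y}
    {w' : B ⟶ Y} (h : IsPushout w i i' w') (hi : (genCof p).rlp.llp i) (hw : IsHomologyIso w) :
    IsHomologyIso w' := by
  rw [isHomologyIso_iff] at hw ⊢
  intro k
  have sq : ∀ n, IsPushout ((ev p k).map (w.f n)) ((ev p k).map (i.f n)) ((ev p k).map (i'.f n))
      ((ev p k).map (w'.f n)) := fun n =>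
    (h.map (HomologicalComplex.eval (AlgModel p) (ComplexShape.down ℤ) n)).map (ev p k)
  refine quasiIso_of_pushout_elements ((dgEv p k).map w) ((dgEv p k).map i) ((dgEv p k).map i')
    ((dgEv p k).map w') (fun n => ConcreteCategory.congr_hom (sq n).w) (fun n => ?_)
    (fun n => exists_eq_add_of_isPushout (sq n)) (fun n _ _ => exists_of_isPushout (sq n)) (hw k)
  obtain ⟨r, hr⟩ := exists_retraction_of_llp hi n
  refine Function.LeftInverse.injective (g := (ev p k).map r) fun x => ?_
  refine (ev_map_comp_apply (i.f n) r x).trans ?_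
  rw [hr, CategoryTheory.Functor.map_id]
  rfl

lemma isHomologyIso_of_isPullback {A B X Y : DGAlgModel p} {w' : A ⟶ B} {q : A ⟶ X} {f : B ⟶ Y}
    {w : X ⟶ Y} (h : IsPullback w' q f w) (hf : IsSurjection f) (hw : IsHomologyIso w) :
    IsHomologyIso w' := by
  rw [isHomologyIso_iff] at hw ⊢
  rw [isSurjection_iff] at hf
  intro k
  have sq : ∀ n, IsPullback (w'.f n) (q.f n) (f.f n) (w.f n) := fun n =>
    h.map (HomologicalComplex.eval (AlgModel p) (ComplexShape.down ℤ) n)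
  refine quasiIso_of_pullback_elements ((dgEv p k).map w') ((dgEv p k).map q) ((dgEv p k).map f)
    ((dgEv p k).map w) (fun n a => ?_) (hf k) (fun n a => eq_zero_of_isPullback (sq n) k)
    (fun n b x => exists_of_isPullback (sq n) k) (hw k)
  refine (ev_map_comp_apply (w'.f n) (f.f n) a).trans ?_
  exact (congrArg (fun t => (ev p k).map t a) (sq n).w).trans (ev_map_comp_apply _ _ _).symm

end Proper

/-! ### The model structure -/

section ModelStructure

variable (p : ℕ) [Fact p.Prime]

/-- The model structure on `dg 𝓐(ℤ_p)`. -/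
abbrev dgAlgModelCategory : ModelCategory (DGAlgModel p) := by
  let : CategoryWithFibrations (DGAlgModel p) := ⟨fun _ _ f => IsSurjection f⟩
  let : CategoryWithCofibrations (DGAlgModel p) := ⟨(genCof p).rlp.llp⟩
  let : CategoryWithWeakEquivalences (DGAlgModel p) := ⟨fun _ _ f => IsHomologyIso f⟩
  have hJ : (genAcyclicCof p).rlp = fibrations (DGAlgModel p) := by
    ext X Y f
    exact rlp_genAcyclicCof_iff f
  have hI : (genCof p).rlp = trivialFibrations (DGAlgModel p) := by
    ext X Y f
    exact rlp_genCof_iff f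
  have hIJ : (genCof p).rlp ≤ (genAcyclicCof p).rlp := fun X Y f hf =>
    (rlp_genAcyclicCof_iff f).2 ((rlp_genCof_iff f).1 hf).1
  have hC : (genAcyclicCof p).rlp.llp = trivialCofibrations (DGAlgModel p) := by
    refine le_antisymm (fun A B i hi => ⟨MorphismProperty.antitone_llp hIJ i hi,
      isHomologyIso_of_llp hi⟩) (fun A B i hi => ?_)
    -- Retract argument: by two-out-of-three the second factor is an acyclic fibration, so `i` lifts
    -- against it and is a retract of the first factor.
    let d := MorphismProperty.factorizationData (genAcyclicCof p).rlp.llp (genAcyclicCof p).rlp i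
    have hp : (genCof p).rlp d.p := (rlp_genCof_iff _).2 ⟨(rlp_genAcyclicCof_iff _).1 d.hp,
      isHomologyIso_of_comp_left (isHomologyIso_of_llp d.hi) (by rw [d.fac]; exact hi.2)⟩
    have := hi.1 d.p hp
    exact MorphismProperty.of_retract (RetractArrow.ofLeftLiftingProperty d.fac) d.hi
  have : (weakEquivalences (DGAlgModel p)).HasTwoOutOfThreeProperty :=
    { comp_mem _ _ hf hg := isHomologyIso_comp hf hg
      of_postcomp _ _ hg h := isHomologyIso_of_comp_right hg h
      of_precomp _ _ hf h := isHomologyIso_of_comp_left hf h }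
  have : MorphismProperty.IsWeakFactorizationSystem (cofibrations (DGAlgModel p))
      (trivialFibrations (DGAlgModel p)) := by
    rw [← hI]
    exact
      { rlp := MorphismProperty.rlp_llp_rlp _
        llp := rfl
        hasFactorization := inferInstanceAs
          (MorphismProperty.HasFactorization (genCof p).rlp.llp (genCof p).rlp) }
  have : MorphismProperty.IsWeakFactorizationSystem (trivialCofibrations (DGAlgModel p))
      (fibrations (DGAlgModel p)) := by
    rw [← hJ, ← hC]
    exact
      { rlp := MorphismProperty.rlp_llp_rlp _
        llp := rfl
        hasFactorization := inferInstance }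
  exact ModelCategory.mk' _

end ModelStructure

end

end ZpModel

theorem mainTheorem9 (p : ℕ) [Fact p.Prime] :
    HasLimits (ZpModel.DGAlgModel p) ∧ HasColimits (ZpModel.DGAlgModel p) ∧
      ∃ _ : ModelCategory (ZpModel.DGAlgModel p),
        (∀ {X Y : ZpModel.DGAlgModel p} (f : X ⟶ Y),
          WeakEquivalence f ↔ ZpModel.IsHomologyIso f) ∧
        (∀ {X Y : ZpModel.DGAlgModel p} (f : X ⟶ Y),
          Fibration f ↔ ZpModel.IsSurjection f) ∧
        ZpModel.IsProper (ZpModel.DGAlgModel p) ∧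
        ZpModel.IsCofibrantlyGeneratedBy (ZpModel.genCof p) (ZpModel.genAcyclicCof p) := by
  refine ⟨inferInstance, inferInstance, ZpModel.dgAlgModelCategory p, ?_⟩
  let := ZpModel.dgAlgModelCategory p
  have hW : ∀ {X Y : ZpModel.DGAlgModel p} (f : X ⟶ Y),
      WeakEquivalence f ↔ ZpModel.IsHomologyIso f :=
    fun f => weakEquivalence_iff f
  have hF : ∀ {X Y : ZpModel.DGAlgModel p} (f : X ⟶ Y), Fibration f ↔ ZpModel.IsSurjection f :=
    fun f => fibration_iff f
  refine ⟨hW, hF, ⟨fun w i i' w' h hi hw => ?_, fun w' q f w h hf hw => ?_⟩,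
    ⟨inferInstance, inferInstance, ?_, ?_⟩⟩
  · exact (hW _).2 (ZpModel.isHomologyIso_of_isPushout h ((cofibration_iff i).1 hi) ((hW _).1 hw))
  · exact (hW _).2 (ZpModel.isHomologyIso_of_isPullback h ((hF _).1 hf) ((hW _).1 hw))
  · ext X Y f
    exact ZpModel.rlp_genAcyclicCof_iff f
  · ext X Y f
    exact ZpModel.rlp_genCof_iff f
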